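/- Let $\Gamma=\mathrm{SL}_2(\mathbb Z)$, let $\Gamma_\infty=\{\pm\begin{pmatrix}1&m\\0&1\end{pmatrix}: m\in\mathbb Z\}$ be the stabiliser of the cusp $\infty$, and for $\gamma=\begin{pmatrix}*&*\\c&d\end{pmatrix}\in\Gamma$ and $z$ in the upper half plane $\mathbb H$ put $j_\gamma(z)=\frac{cz+d}{|cz+d|}$. Let $\psi:(0,\infty)\to\mathbb C$ be smooth with compact support, and let $\Psi(s)=\int_0^\infty\psi(y)y^{s}\,\frac{dy}{y}$ be its Mellin transform. For an even integer $k$ let $$E_k(z|\psi)=\sum_{\gamma\in\Gamma_\infty\backslash\Gamma}\psi(\operatorname{Im}\gamma z)\,j_\gamma(z)^{-k}\qquad(z\in\mathbb H)$$ be the incomplete Eisenstein series of weight $k$, and for $n\in\mathbb Z$ and $y>0$ let $a_n(y)=a_n(k,\psi;y)=\int_0^1E_k(x+iy|\psi)\,e(-nx)\,dx$, where $e(t)=e^{2\pi i t}$. The series defining $E_k(z|\psi)$ converges absolutely for every $z\in\mathbb H$, and $E_k$ has the absolutely convergent Fourier expansion $$E_k(x+iy|\psi)=\sum_{n\in\mathbb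 Z}a_n(y)\,e(nx)\qquad(x\in\mathbb R,\ y>0).$$ Moreover: (1) For all even integers $k$ and all $y>0$, $$a_0(y)=\delta_{k=0}\,\frac{3}{\pi}\,\Psi(-1)+O(\sqrt y),$$ where $\delta_{k=0}$ is $1$ if $k=0$ and $0$ otherwise, and the implied constant depends only on $\psi$. (2) For every $\epsilon>0$ and every integer $A\ge 0$, for all even integers $k$, all integers $n\neq0$ and all $y>0$, $$a_n(y)+a_{-n}(y)\ll 2^{|k|}(1+|k|)^{A}\,\sqrt y\,\tau(|n|)\left(\frac{1}{|n|y}\right)^{A}\left(1+\frac{1}{|n|y}\right)^{\epsilon},$$ where $\tau$ is the number-of-divisors function and the implied constant depends only on $\psi$, $\epsilon$ and $A$. -/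

import Mathlib

open scoped MatrixGroups

namespace IncompleteEisenstein

/-- The stabiliser `Γ_∞ = {± [1, n; 0, 1]}` of the cusp `∞` in `Γ = SL₂(ℤ)`. -/
def gammaInf : Subgroup SL(2, ℤ) where
  carrier := {γ | γ 1 0 = 0}
  mul_mem' := by
    intro a b ha hb
    simp only [Set.mem_ofPred_eq] at ha hb ⊢
    simp [Matrix.mul_apply, Fin.sum_univ_two, ha, hb]
  one_mem' := by simp
  inv_mem' := by
    intro a ha
    simp only [Set.mem_ofPred_eq] at ha ⊢
    simp [Matrix.SpecialLinearGroup.coe_inv, Matrix.adjugate_fin_two, ha]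

/-- `c z + d`, where `(c, d)` is the bottom row of `γ`. -/
noncomputable def cocycle (γ : SL(2, ℤ)) (z : UpperHalfPlane) : ℂ :=
  (γ 1 0 : ℂ) * (z : ℂ) + (γ 1 1 : ℂ)

/-- The weight factor `j_γ(z) = (c z + d) / |c z + d|`. -/
noncomputable def autFactor (γ : SL(2, ℤ)) (z : UpperHalfPlane) : ℂ :=
  cocycle γ z / (‖cocycle γ z‖ : ℂ)

/-- The summand `ψ(Im γz) j_γ(z)^{-k}`. -/
noncomputable def summand (k : ℤ) (ψ : ℝ → ℂ) (z : UpperHalfPlane) (γ : SL(2, ℤ)) : ℂ :=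
  ψ (γ • z).im * autFactor γ z ^ (-k)

theorem im_smul_eq (γ : SL(2, ℤ)) (z : UpperHalfPlane) :
    (γ • z).im = z.im / Complex.normSq (cocycle γ z) := by
  rw [ModularGroup.im_smul_eq_div_normSq,
    ModularGroup.denom_apply]
  rfl

/-- For even `k` the summand depends only on the coset `Γ_∞ γ`. -/
theorem summand_eq {k : ℤ} (hk : Even k) (ψ : ℝ → ℂ) (z : UpperHalfPlane) (γ γ' : SL(2, ℤ))
    (h : QuotientGroup.rightRel gammaInf γ γ') : summand k ψ z γ = summand k ψ z γ' := by
  rw [QuotientGroup.rightRel_apply] at h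
  obtain ⟨δ, hδ, rfl⟩ : ∃ δ ∈ gammaInf, δ * γ = γ' := ⟨_, h, by group⟩
  have h0 : δ 1 0 = 0 := hδ
  have hdet : δ 0 0 * δ 1 1 = 1 := by
    have := δ.det_coe
    rw [Matrix.det_fin_two, h0] at this
    simpa using this
  have hc : cocycle (δ * γ) z = (δ 1 1 : ℂ) * cocycle γ z := by
    simp [cocycle, Matrix.mul_apply, Fin.sum_univ_two, h0]
    ring
  have h1 : δ 1 1 = 1 ∨ δ 1 1 = -1 :=
    Int.isUnit_iff.mp (IsUnit.of_mul_eq_one_right _ hdet)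
  rcases h1 with h1 | h1
  · have hc' : cocycle (δ * γ) z = cocycle γ z := by rw [hc, h1]; simp
    simp only [summand, autFactor, im_smul_eq, hc']
  · have hc' : cocycle (δ * γ) z = -cocycle γ z := by rw [hc, h1]; simp
    simp only [summand, autFactor, im_smul_eq, hc', Complex.normSq_neg, norm_neg, neg_div,
      hk.neg.neg_zpow]

/-- The set `Γ_∞ \ Γ` of cosets `Γ_∞ γ`. -/
abbrev Cosets : Type := Quotient (QuotientGroup.rightRel gammaInf)

/-- The summand of the incomplete Eisenstein series, as a function on `Γ_∞ \ Γ`. -/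
noncomputable def cosetSummand (k : ℤ) (hk : Even k) (ψ : ℝ → ℂ) (z : UpperHalfPlane) :
    Cosets → ℂ :=
  Quotient.lift (summand k ψ z) (summand_eq hk ψ z)

/-- The incomplete Eisenstein series
`E_k(z | ψ) = ∑_{γ ∈ Γ_∞ \ Γ} ψ(Im γz) j_γ(z)^{-k}` of even weight `k`. -/
noncomputable def incompleteEisenstein (k : ℤ) (hk : Even k) (ψ : ℝ → ℂ)
    (z : UpperHalfPlane) : ℂ :=
  ∑' γ : Cosets, cosetSummand k hk ψ z γ

/-- The point `x + i y` of the upper half plane. -/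
def point (x y : ℝ) (hy : 0 < y) : UpperHalfPlane := ⟨⟨x, y⟩, hy⟩

/-- `e(t) = exp(2 π i t)`. -/
noncomputable def e (t : ℝ) : ℂ := Complex.exp (2 * Real.pi * Complex.I * t)

/-- The `n`-th Fourier coefficient `a_n(y) = ∫₀¹ E_k(x + i y | ψ) e(-n x) dx`. -/
noncomputable def coeff (k : ℤ) (hk : Even k) (ψ : ℝ → ℂ) (n : ℤ) (y : ℝ) (hy : 0 < y) : ℂ :=
  ∫ x in (0 : ℝ)..1, incompleteEisenstein k hk ψ (point x y hy) * e (-(n * x))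

/-- The number `τ(n)` of positive divisors of `n`. -/
def tau (n : ℕ) : ℕ := n.divisors.card

end IncompleteEisenstein

/-!
The coset sum is indexed by the coprime bottom rows `(c, d)` with `c > 0`, together with `(0, 1)`.
Grouping the rows by `c` and by the residue of `d` modulo `c` writes `E_k(x + i y | ψ)` as `ψ(y)`
plus finitely many translated periodizations of compactly supported functions of `x`. Poisson
summation gives the Fourier expansion, and
`a_n(y) = δ_{n = 0} ψ(y) + √y ∑_c R(n, c) / c · G(c √y, n √y / c)`, where `R(n, c)` is a Ramanujan sum
and `G(u, ξ) = ∫ ρ(v² + u²) exp(-i k θ) e(-ξ v) dv` with `ρ(t) = ψ(1/t)` and `θ = arg (v + i u)`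
(`coeff_eq`, `fourierInt_rowFun`).

For `n ≠ 0` repeated integration by parts bounds `G` by `(max 1 |k| / |ξ|)^κ`, uniformly in `u`
(`exists_norm_oscInt_le_pow`, `exists_norm_oscInt_le_rpow`). Since `G` vanishes for `c √y` large and
Ramanujan sums are of size `τ(|n|)` on average (`sum_norm_ramanujanSum_le`), taking `κ = A`, or
`κ = min ε 1` when `A = 0`, bounds `a_n` and `a_{-n}` separately.

For `n = 0` the point is to save the logarithm and to be uniform in `k`. Write `g(u) = G(u, 0)`. The
sum `∑ φ(c)/c g(c √y)` is the integral of the Riesz mean `∑_{c ≤ x} (φ(c)/c) (x - c)` against the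
second derivative of `x ↦ g(x √y)`, and this Riesz mean is `(3/π²) x² + O(x)` by the boundedness of
`∑_{d ≤ x} μ(d)/d` (`riesz_mean_totient_bound`). What remains is to bound `∫ u |g''(u)| du`
independently of `k`. The operator `u d/du` acts on `g` through an Euler operator on `ρ`
(`hasDerivAt_lineInt`), so `u² g''` is again an integral of the same kind. It is `O(min(K u, 1/(K u)))`
with `K = max 1 |k|` (`exists_norm_lineInt_euler_le_div`), which is integrable against `du/u` with a
bound independent of `K`. The main term is computed by Fubini (`integral_lineInt`); the angular
integral of `exp(-i k θ)` vanishes unless `k = 0`.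
-/

namespace IncompleteEisenstein

section

open Finset ArithmeticFunction
open scoped ArithmeticFunction.Moebius

/-! ### Sums over divisors -/

theorem sum_Ioc_sum_divisorsAntidiagonal {M : Type*} [AddCommMonoid M] (F : ℕ → ℕ → M) (N : ℕ) :
    ∑ c ∈ Ioc 0 N, ∑ p ∈ c.divisorsAntidiagonal, F p.1 p.2 =
      ∑ d ∈ Ioc 0 N, ∑ m ∈ Ioc 0 (N / d), F d m := by
  have h1 : ∑ c ∈ Ioc 0 N, ∑ p ∈ c.divisorsAntidiagonal, F p.1 p.2 =
      ∑ c ∈ Ioc 0 N, ∑ p ∈ Ioc 0 N ×ˢ Ioc 0 N with p.1 * p.2 = c, F p.1 p.2 := by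
    refine sum_congr rfl fun c hc ↦ ?_
    simp only [mem_Ioc] at hc
    rw [Nat.divisorsAntidiagonal_eq_prod_filter_of_le hc.1.ne' hc.2]
  have h2 : ∑ c ∈ Ioc 0 N, ∑ p ∈ Ioc 0 N ×ˢ Ioc 0 N with p.1 * p.2 = c, F p.1 p.2 =
      ∑ p ∈ Ioc 0 N ×ˢ Ioc 0 N with p.1 * p.2 ≤ N, F p.1 p.2 := by
    simp_rw [sum_filter]
    rw [sum_comm]
    refine sum_congr rfl fun p hp ↦ ?_
    simp only [mem_product, mem_Ioc] at hp
    by_cases h : p.1 * p.2 ≤ N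
    · simp [h, Nat.mul_pos hp.1.1 hp.2.1]
    · simp [h]
  rw [h1, h2, sum_filter, sum_product]
  refine sum_congr rfl fun d hd ↦ ?_
  rw [mem_Ioc] at hd
  rw [← sum_filter]
  congr 1
  ext m
  simp only [mem_filter, mem_Ioc, and_assoc]
  refine and_congr_right fun _ ↦ ⟨fun h ↦ ?_, fun h ↦ ?_⟩
  · rw [Nat.le_div_iff_mul_le hd.1, mul_comm]
    exact h.2
  · refine ⟨h.trans (Nat.div_le_self _ _), ?_⟩
    rwa [Nat.le_div_iff_mul_le hd.1, mul_comm] at h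

theorem sum_moebius_mul_floor (n : ℕ) (hn : 1 ≤ n) :
    ∑ d ∈ Ioc 0 n, (μ d : ℝ) * ((n / d : ℕ) : ℝ) = 1 := by
  have h := sum_Ioc_mul_zeta_eq_sum μ n
  rw [moebius_mul_coe_zeta] at h
  have h2 : ∑ d ∈ Ioc 0 n, (1 : ArithmeticFunction ℤ) d = 1 := by
    rw [sum_eq_single_of_mem 1 (by simp; lia)]
    · simp
    · intro b _ hb
      exact one_apply_ne hb
  rw [h2] at h
  have h3 := congrArg (Int.cast : ℤ → ℝ) h
  simp only [Int.cast_sum, Int.cast_mul, Int.cast_natCast, Int.cast_one] at h3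
  exact h3.symm

theorem abs_moebius_real_le_one (d : ℕ) : |(μ d : ℝ)| ≤ 1 := by
  exact_mod_cast abs_moebius_le_one (n := d)

/-- The partial sums of `∑ μ(d)/d` are bounded: replace `n/d` by its integer part in
`∑ μ(d) ⌊n/d⌋ = 1`. -/
theorem abs_sum_moebius_div_le (n : ℕ) : |∑ d ∈ Ioc 0 n, (μ d : ℝ) / d| ≤ 2 := by
  rcases Nat.eq_zero_or_pos n with rfl | hn
  · simp
  have hn' : (1 : ℝ) ≤ n := by exact_mod_cast hn
  have h : |n * ∑ d ∈ Ioc 0 n, (μ d : ℝ) / d - 1| ≤ n := by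
    rw [← sum_moebius_mul_floor n hn, mul_sum, ← sum_sub_distrib]
    refine (abs_sum_le_sum_abs _ _).trans ?_
    calc _ ≤ ∑ d ∈ Ioc 0 n, (1 : ℝ) := by
          refine sum_le_sum fun d hd ↦ ?_
          rw [mem_Ioc] at hd
          have hd0 : (0 : ℝ) < d := by exact_mod_cast hd.1
          have e1 : (n : ℝ) * ((μ d : ℝ) / d) - μ d * ((n / d : ℕ) : ℝ) =
              μ d * ((n : ℝ) / d - ((n / d : ℕ) : ℝ)) := by ring
          rw [e1, abs_mul]
          have e2 : |(n : ℝ) / d - ((n / d : ℕ) : ℝ)| ≤ 1 := by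
            rw [← Nat.floor_div_eq_div (K := ℝ), abs_le]
            have := Nat.floor_le (a := (n : ℝ) / d) (by positivity)
            have := Nat.lt_floor_add_one ((n : ℝ) / d)
            constructor <;> linarith
          exact mul_le_one₀ (abs_moebius_real_le_one d) (abs_nonneg _) e2
      _ = n := by simp
  have h3 : |n * ∑ d ∈ Ioc 0 n, (μ d : ℝ) / d| ≤ n * 2 := by
    have := abs_sub_abs_le_abs_sub (n * ∑ d ∈ Ioc 0 n, (μ d : ℝ) / d) 1
    rw [abs_one] at this
    linarith
  rw [abs_mul, abs_of_nonneg (by linarith : (0 : ℝ) ≤ n)] at h3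
  exact le_of_mul_le_mul_left h3 (by linarith)

theorem hasSum_moebius_div_sq : HasSum (fun d : ℕ ↦ (μ d : ℝ) / (d : ℝ) ^ 2) (6 / Real.pi ^ 2) := by
  have h2 : (1 : ℝ) < (2 : ℂ).re := by simp
  have hs := LSeriesSummable_moebius_iff.mpr h2
  have h := LSeries_one_mul_Lseries_moebius h2
  rw [LSeries_one_eq_riemannZeta h2, riemannZeta_two] at h
  have hpi : (Real.pi : ℂ) ≠ 0 := by exact_mod_cast Real.pi_ne_zero
  have hv : LSeries (fun n ↦ ((μ n : ℤ) : ℂ)) 2 = 6 / (Real.pi : ℂ) ^ 2 := by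
    field_simp at h ⊢
    linear_combination h
  have hS := hs.hasSum
  rw [show ∑' n, LSeries.term (fun n ↦ ((μ n : ℤ) : ℂ)) 2 n = 6 / (Real.pi : ℂ) ^ 2 from hv] at hS
  rw [← Complex.hasSum_ofReal]
  convert! hS using 1
  · ext d
    rcases eq_or_ne d 0 with rfl | hd
    · simp
    · rw [LSeries.term_of_ne_zero hd]
      push_cast
      norm_cast
  · push_cast
    rfl

theorem abs_sum_moebius_div_sq_sub_le (n : ℕ) :
    |∑ d ∈ Ioc 0 n, (μ d : ℝ) / (d : ℝ) ^ 2 - 6 / Real.pi ^ 2| ≤ 2 / ((n : ℝ) + 1) := by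
  have h := hasSum_moebius_div_sq.tendsto_sum_nat
  have h2 : Filter.Tendsto (fun m ↦ |∑ d ∈ Ioc 0 n, (μ d : ℝ) / (d : ℝ) ^ 2 -
      ∑ d ∈ range m, (μ d : ℝ) / (d : ℝ) ^ 2|) Filter.atTop
      (nhds |∑ d ∈ Ioc 0 n, (μ d : ℝ) / (d : ℝ) ^ 2 - 6 / Real.pi ^ 2|) :=
    (tendsto_const_nhds.sub h).abs
  refine le_of_tendsto h2 ?_
  filter_upwards [Filter.eventually_ge_atTop (n + 1)] with m hm
  have e1 : ∑ d ∈ range m, (μ d : ℝ) / (d : ℝ) ^ 2 =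
      ∑ d ∈ Ioc 0 n, (μ d : ℝ) / (d : ℝ) ^ 2 + ∑ d ∈ Ioo n m, (μ d : ℝ) / (d : ℝ) ^ 2 := by
    rw [← sum_union (by rw [disjoint_left]; intro a; simp; lia)]
    symm
    refine sum_subset (fun a ↦ by simp; lia) fun a h1 h2 ↦ ?_
    have : a = 0 := by
      simp at h1 h2
      lia
    simp [this]
  rw [e1, sub_add_cancel_left, abs_neg]
  refine (abs_sum_le_sum_abs _ _).trans (le_trans ?_ (sum_Ioo_inv_sq_le n m))
  refine sum_le_sum fun d _ ↦ ?_
  rw [abs_div, abs_of_nonneg (by positivity : (0 : ℝ) ≤ (d : ℝ) ^ 2), div_eq_mul_inv]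
  exact mul_le_of_le_one_left (by positivity) (abs_moebius_real_le_one d)

/-! ### The Riesz mean of `φ(c)/c` -/

theorem totient_div_eq_sum (c : ℕ) (hc : c ≠ 0) :
    (Nat.totient c : ℝ) / c = ∑ p ∈ c.divisorsAntidiagonal, (μ p.1 : ℝ) / p.1 := by
  have h := (sum_eq_iff_sum_mul_moebius_eq (f := fun n ↦ (Nat.totient n : ℝ))
    (g := fun n ↦ (n : ℝ))).mp (fun n _ ↦ by exact_mod_cast Nat.sum_totient n) c
      (Nat.pos_of_ne_zero hc)
  rw [← h, sum_div]
  refine sum_congr rfl fun p hp ↦ ?_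
  have hp' := Nat.mem_divisorsAntidiagonal.mp hp
  have h1 : (c : ℝ) = p.1 * p.2 := by rw [← hp'.1]; push_cast; rfl
  have h3 : (p.2 : ℝ) ≠ 0 := by
    exact_mod_cast (Nat.right_ne_zero_of_mem_divisorsAntidiagonal hp)
  rw [h1, mul_div_mul_right _ _ h3]

theorem sum_sub_nat_bound {t : ℝ} (ht : 0 ≤ t) :
    |∑ m ∈ Ioc 0 ⌊t⌋₊, (t - m) - (t ^ 2 / 2 - t / 2)| ≤ 1 := by
  have hs : ∀ q : ℕ, ∑ m ∈ Ioc 0 q, (t - m) = t * q - q * (q + 1) / 2 := by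
    intro q
    induction q with
    | zero => simp
    | succ q ih =>
      rw [sum_Ioc_succ_top (by lia), ih]
      push_cast
      ring
  rw [hs]
  have h1 := Nat.floor_le ht
  have h2 := Nat.lt_floor_add_one t
  set q : ℝ := (⌊t⌋₊ : ℝ)
  rw [abs_le]
  constructor <;> nlinarith

/-- The Riesz mean `∑_{c ≤ x} (φ(c)/c) (x - c)` equals `(3/π²) x²` up to `O(x)`. The saving over the
unsmoothed sum comes from the secondary term `-(x/2) ∑_{d ≤ x} μ(d)/d`, which is `O(x)`. -/
theorem riesz_mean_totient_bound {x : ℝ} (hx : 0 ≤ x) :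
    |∑ c ∈ Ioc 0 ⌊x⌋₊, (Nat.totient c : ℝ) / c * (x - c) - 3 / Real.pi ^ 2 * x ^ 2| ≤ 3 * x := by
  set n := ⌊x⌋₊ with hn
  have hnx : (n : ℝ) ≤ x := Nat.floor_le hx
  have hnx' : x < n + 1 := Nat.lt_floor_add_one x
  have e1 : ∑ c ∈ Ioc 0 n, (Nat.totient c : ℝ) / c * (x - c) =
      ∑ d ∈ Ioc 0 n, (μ d : ℝ) * ∑ m ∈ Ioc 0 ⌊x / d⌋₊, (x / d - m) := by
    have := sum_Ioc_sum_divisorsAntidiagonal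
      (fun d m ↦ (μ d : ℝ) / d * (x - d * m)) n
    have e2 : ∑ c ∈ Ioc 0 n, (Nat.totient c : ℝ) / c * (x - c) =
        ∑ c ∈ Ioc 0 n, ∑ p ∈ c.divisorsAntidiagonal, (μ p.1 : ℝ) / p.1 * (x - p.1 * p.2) := by
      refine sum_congr rfl fun c hc ↦ ?_
      rw [mem_Ioc] at hc
      rw [totient_div_eq_sum c hc.1.ne', sum_mul]
      refine sum_congr rfl fun p hp ↦ ?_
      rw [← (Nat.mem_divisorsAntidiagonal.mp hp).1]
      push_cast
      rfl
    rw [e2, this]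
    refine sum_congr rfl fun d hd ↦ ?_
    rw [mem_Ioc] at hd
    have hd0 : (d : ℝ) ≠ 0 := by exact_mod_cast hd.1.ne'
    rw [Nat.floor_div_natCast, mul_sum]
    refine sum_congr rfl fun m _ ↦ ?_
    field_simp
  have e3 : ∑ d ∈ Ioc 0 n, (μ d : ℝ) * ∑ m ∈ Ioc 0 ⌊x / d⌋₊, (x / d - m) -
      3 / Real.pi ^ 2 * x ^ 2 =
      ∑ d ∈ Ioc 0 n, (μ d : ℝ) * (∑ m ∈ Ioc 0 ⌊x / d⌋₊, (x / d - m) -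
          ((x / d) ^ 2 / 2 - (x / d) / 2)) +
        x ^ 2 / 2 * (∑ d ∈ Ioc 0 n, (μ d : ℝ) / (d : ℝ) ^ 2 - 6 / Real.pi ^ 2) -
        x / 2 * ∑ d ∈ Ioc 0 n, (μ d : ℝ) / d := by
    simp only [mul_sub, sum_sub_distrib]
    have e4 : ∑ d ∈ Ioc 0 n, (μ d : ℝ) * ((x / d) ^ 2 / 2) =
        x ^ 2 / 2 * ∑ d ∈ Ioc 0 n, (μ d : ℝ) / (d : ℝ) ^ 2 := by
      rw [mul_sum]
      exact sum_congr rfl fun d _ ↦ by ring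
    have e5 : ∑ d ∈ Ioc 0 n, (μ d : ℝ) * (x / d / 2) =
        x / 2 * ∑ d ∈ Ioc 0 n, (μ d : ℝ) / (d : ℝ) := by
      rw [mul_sum]
      exact sum_congr rfl fun d _ ↦ by ring
    rw [e4, e5]
    ring
  rw [e1, e3]
  have b1 : |∑ d ∈ Ioc 0 n, (μ d : ℝ) * (∑ m ∈ Ioc 0 ⌊x / d⌋₊, (x / d - m) -
          ((x / d) ^ 2 / 2 - (x / d) / 2))| ≤ x := by
    refine (abs_sum_le_sum_abs _ _).trans (le_trans ?_ hnx)
    calc _ ≤ ∑ d ∈ Ioc 0 n, (1 : ℝ) := by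
          refine sum_le_sum fun d _ ↦ ?_
          rw [abs_mul]
          exact mul_le_one₀ (abs_moebius_real_le_one d) (abs_nonneg _)
            (sum_sub_nat_bound (by positivity))
      _ = n := by simp
  have b2 : |x ^ 2 / 2 * (∑ d ∈ Ioc 0 n, (μ d : ℝ) / (d : ℝ) ^ 2 - 6 / Real.pi ^ 2)| ≤ x := by
    rw [abs_mul, abs_of_nonneg (by positivity)]
    calc _ ≤ x ^ 2 / 2 * (2 / (n + 1)) := by
          gcongr
          exact abs_sum_moebius_div_sq_sub_le n
      _ = x * (x / (n + 1)) := by ring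
      _ ≤ x := by
          refine mul_le_of_le_one_right hx ?_
          rw [div_le_one (by positivity)]
          exact hnx'.le
  have b3 : |x / 2 * ∑ d ∈ Ioc 0 n, (μ d : ℝ) / d| ≤ x := by
    rw [abs_mul, abs_of_nonneg (by positivity)]
    calc _ ≤ x / 2 * 2 := by
          gcongr
          exact abs_sum_moebius_div_le n
      _ = x := by ring
  rw [abs_le] at b1 b2 b3 ⊢
  constructor <;> linarith

/-! ### Ramanujan sums -/

/-- The Ramanujan sum `∑ e(n r / c)` over the residues `0 ≤ r < c` prime to `c`. -/
noncomputable def ramanujanSum (n : ℤ) (c : ℕ) : ℂ :=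
  ∑ r ∈ (range c).filter c.Coprime, e (n * r / c)

theorem norm_e (t : ℝ) : ‖e t‖ = 1 := by
  rw [e, show (2 * Real.pi * Complex.I * t : ℂ) = ((2 * Real.pi * t : ℝ) : ℂ) * Complex.I by
    push_cast; ring]
  exact Complex.norm_exp_ofReal_mul_I _

theorem e_zero : e 0 = 1 := by simp [e]

theorem e_add (s t : ℝ) : e (s + t) = e s * e t := by
  rw [e, e, e, ← Complex.exp_add]
  push_cast
  ring_nf

theorem e_int (n : ℤ) : e n = 1 := by
  rw [e, Complex.exp_eq_one_iff]
  exact ⟨n, by push_cast; ring⟩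

theorem e_nat_mul (m : ℕ) (t : ℝ) : e (m * t) = e t ^ m := by
  rw [e, e, ← Complex.exp_nat_mul]
  push_cast
  ring_nf

theorem ramanujanSum_zero (c : ℕ) : ramanujanSum 0 c = Nat.totient c := by
  simp [ramanujanSum, e_zero, Nat.totient]

/-- The full exponential sum modulo `q` vanishes unless `q ∣ n`. -/
theorem norm_sum_range_e_le (n : ℤ) {q : ℕ} (hq : 0 < q) :
    ‖∑ s ∈ range q, e (n * s / q)‖ ≤ if (q : ℤ) ∣ n then (q : ℝ) else 0 := by
  have hq' : (q : ℝ) ≠ 0 := by exact_mod_cast hq.ne'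
  split_ifs with h
  · refine (norm_sum_le _ _).trans ?_
    simp [norm_e]
  · have h1 : ∀ s : ℕ, e (n * s / q) = e (n / q) ^ s := by
      intro s
      rw [← e_nat_mul]
      congr 1
      ring
    have hne : e (n / q) ≠ 1 := by
      intro hc
      rw [e, Complex.exp_eq_one_iff] at hc
      obtain ⟨m, hm⟩ := hc
      apply h
      refine ⟨m, ?_⟩
      have h2 : (2 * Real.pi * Complex.I : ℂ) ≠ 0 := Complex.two_pi_I_ne_zero
      rw [mul_comm (m : ℂ)] at hm
      have h3 := mul_left_cancel₀ h2 hm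
      have h4 : (n : ℝ) / q = m := by exact_mod_cast h3
      rw [div_eq_iff hq'] at h4
      have h5 : (n : ℝ) = ((q * m : ℤ) : ℝ) := by rw [h4]; push_cast; ring
      exact_mod_cast h5
    have h0 : (e (n / q) - 1) * ∑ s ∈ range q, e (n * s / q) = 0 := by
      simp_rw [h1]
      rw [mul_comm, geom_sum_mul, ← e_nat_mul, mul_div_cancel₀ _ hq', e_int, sub_self]
    rw [(mul_eq_zero.mp h0).resolve_left (sub_ne_zero.mpr hne)]
    simp

theorem norm_ramanujanSum_le (n : ℤ) {c : ℕ} (hc : 0 < c) :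
    ‖ramanujanSum n c‖ ≤ ∑ d ∈ c.divisors, if (d : ℤ) ∣ n then (d : ℝ) else 0 := by
  have hcop : ∀ r, (if c.Coprime r then (1 : ℂ) else 0) =
      ∑ d ∈ c.divisors, if d ∣ r then (μ d : ℂ) else 0 := by
    intro r
    have h1 := DFunLike.congr_fun moebius_mul_coe_zeta (c.gcd r)
    rw [coe_mul_zeta_apply] at h1
    rw [← sum_filter]
    have h2 : c.divisors.filter (· ∣ r) = (c.gcd r).divisors := by
      ext d
      simp [Nat.dvd_gcd_iff, hc.ne', Nat.gcd_eq_zero_iff]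
    rw [h2]
    have h3 : ((∑ i ∈ (c.gcd r).divisors, μ i : ℤ) : ℂ) =
        (((1 : ArithmeticFunction ℤ) (c.gcd r) : ℤ) : ℂ) := by rw [h1]
    rw [Int.cast_sum] at h3
    rw [h3, one_apply]
    simp only [Nat.coprime_iff_gcd_eq_one]
    split_ifs <;> simp
  have h1 : ramanujanSum n c = ∑ d ∈ c.divisors, (μ d : ℂ) *
      ∑ s ∈ range (c / d), e (n * s / (c / d : ℕ)) := by
    have h2 : ramanujanSum n c = ∑ r ∈ range c, ∑ d ∈ c.divisors,
        if d ∣ r then (μ d : ℂ) * e (n * r / c) else 0 := by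
      rw [ramanujanSum, sum_filter]
      refine sum_congr rfl fun r _ ↦ ?_
      have := congrArg (· * e (n * r / c)) (hcop r)
      simp only [ite_mul, one_mul, zero_mul, sum_mul] at this
      exact this
    rw [h2, sum_comm]
    refine sum_congr rfl fun d hd ↦ ?_
    have hdc := Nat.dvd_of_mem_divisors hd
    have hd0 : 0 < d := Nat.pos_of_mem_divisors hd
    rw [← sum_filter, mul_sum]
    symm
    refine sum_nbij' (fun s ↦ d * s) (fun r ↦ r / d) ?_ ?_ ?_ ?_ ?_
    · intro s hs
      simp only [mem_range, mem_filter] at hs ⊢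
      refine ⟨?_, dvd_mul_right _ _⟩
      rwa [Nat.lt_div_iff_mul_lt_of_dvd hd0.ne' hdc, mul_comm] at hs
    · intro r hr
      simp only [mem_range, mem_filter] at hr ⊢
      exact Nat.div_lt_div_of_lt_of_dvd hdc hr.1
    · intro s _
      exact Nat.mul_div_cancel_left _ hd0
    · intro r hr
      simp only [mem_filter] at hr
      exact Nat.mul_div_cancel' hr.2
    · intro s _
      have hd0' : (d : ℝ) ≠ 0 := by exact_mod_cast hd0.ne'
      have hc' : (c : ℝ) ≠ 0 := by exact_mod_cast hc.ne'
      congr 2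
      rw [Nat.cast_div hdc hd0']
      push_cast
      field_simp
  rw [h1]
  refine (norm_sum_le _ _).trans ?_
  rw [← Nat.sum_div_divisors c (fun d ↦ if (d : ℤ) ∣ n then (d : ℝ) else 0)]
  refine sum_le_sum fun d hd ↦ ?_
  have hdc := Nat.dvd_of_mem_divisors hd
  have hd0 : 0 < d := Nat.pos_of_mem_divisors hd
  rw [norm_mul]
  have hm : ‖((μ d : ℤ) : ℂ)‖ ≤ 1 := by
    rw [Complex.norm_intCast]
    exact abs_moebius_real_le_one d
  exact (mul_le_of_le_one_left (norm_nonneg _) hm).trans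
    (norm_sum_range_e_le n (Nat.div_pos (Nat.le_of_dvd hc hdc) hd0))

theorem sum_Ioc_rpow_le {κ : ℝ} (hκ : 0 < κ) (M : ℕ) :
    ∑ m ∈ Ioc 0 M, (m : ℝ) ^ (κ - 1) ≤ (1 + 1 / κ) * (M : ℝ) ^ κ := by
  rcases le_total 1 κ with h1 | h1
  · calc _ ≤ ∑ m ∈ Ioc 0 M, (M : ℝ) ^ (κ - 1) := by
          refine sum_le_sum fun m hm ↦ ?_
          rw [mem_Ioc] at hm
          exact Real.rpow_le_rpow (by positivity) (by exact_mod_cast hm.2) (by linarith)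
      _ = (M : ℝ) ^ κ := by
          rcases Nat.eq_zero_or_pos M with rfl | hM
          · simp [Real.zero_rpow hκ.ne']
          · have : (0 : ℝ) < M := by exact_mod_cast hM
            rw [sum_const, Nat.card_Ioc, nsmul_eq_mul, Real.rpow_sub_one this.ne']
            simp only [tsub_zero]
            field_simp
      _ ≤ _ := by
          refine le_mul_of_one_le_left (by positivity) ?_
          have : 0 < 1 / κ := by positivity
          linarith
  · have key : ∑ m ∈ Ioc 0 M, (m : ℝ) ^ (κ - 1) ≤ 1 / κ * (M : ℝ) ^ κ := by
      induction M with
      | zero => simp [Real.zero_rpow hκ.ne']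
      | succ M ih =>
        rw [sum_Ioc_succ_top (by lia)]
        have hM : (0 : ℝ) < ((M + 1 : ℕ) : ℝ) := by positivity
        -- Bernoulli's inequality bounds the increment of `M ^ κ` from below
        have hb := rpow_one_add_le_one_add_mul_self (s := -1 / ((M + 1 : ℕ) : ℝ)) (p := κ)
          (by
            rw [le_div_iff₀ hM]
            push_cast
            nlinarith [Nat.cast_nonneg (α := ℝ) M]) hκ.le h1
        have e1 : (M : ℝ) ^ κ ≤ ((M + 1 : ℕ) : ℝ) ^ κ * (1 + κ * (-1 / ((M + 1 : ℕ) : ℝ))) := by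
          have : (M : ℝ) = ((M + 1 : ℕ) : ℝ) * (1 + -1 / ((M + 1 : ℕ) : ℝ)) := by
            field_simp
            push_cast
            ring
          calc (M : ℝ) ^ κ = (((M + 1 : ℕ) : ℝ) * (1 + -1 / ((M + 1 : ℕ) : ℝ))) ^ κ := by
                rw [← this]
            _ = ((M + 1 : ℕ) : ℝ) ^ κ * (1 + -1 / ((M + 1 : ℕ) : ℝ)) ^ κ := by
                refine Real.mul_rpow hM.le ?_
                rw [← mul_nonneg_iff_of_pos_left hM, ← this]
                positivity
            _ ≤ _ := by gcongr
        rw [Real.rpow_sub_one hM.ne']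
        have e2 : 1 / κ * (((M + 1 : ℕ) : ℝ) ^ κ * (1 + κ * (-1 / ((M + 1 : ℕ) : ℝ)))) =
            1 / κ * ((M + 1 : ℕ) : ℝ) ^ κ - ((M + 1 : ℕ) : ℝ) ^ κ / ((M + 1 : ℕ) : ℝ) := by
          field_simp
          ring
        have e3 := mul_le_mul_of_nonneg_left e1 (by positivity : 0 ≤ 1 / κ)
        linarith
    refine key.trans ?_
    gcongr
    linarith

/-- Ramanujan sums are bounded by `τ(n)` on average over the modulus. -/
theorem sum_norm_ramanujanSum_le {κ : ℝ} (hκ : 0 < κ) {n : ℤ} (hn : n ≠ 0) (N : ℕ) :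
    ∑ c ∈ Ioc 0 N, ‖ramanujanSum n c‖ * (c : ℝ) ^ (κ - 1) ≤
      (1 + 1 / κ) * tau n.natAbs * (N : ℝ) ^ κ := by
  have hn' : n.natAbs ≠ 0 := Int.natAbs_ne_zero.mpr hn
  calc ∑ c ∈ Ioc 0 N, ‖ramanujanSum n c‖ * (c : ℝ) ^ (κ - 1)
      ≤ ∑ c ∈ Ioc 0 N, ∑ p ∈ c.divisorsAntidiagonal,
          (if (p.1 : ℤ) ∣ n then (p.1 : ℝ) * ((p.1 * p.2 : ℕ) : ℝ) ^ (κ - 1) else 0) := by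
        refine sum_le_sum fun c hc ↦ ?_
        rw [mem_Ioc] at hc
        refine (mul_le_mul_of_nonneg_right (norm_ramanujanSum_le n hc.1) (by positivity)).trans
          (le_of_eq ?_)
        rw [Nat.sum_divisorsAntidiagonal (f := fun a b ↦
          if (a : ℤ) ∣ n then (a : ℝ) * ((a * b : ℕ) : ℝ) ^ (κ - 1) else 0), sum_mul]
        refine sum_congr rfl fun d hd ↦ ?_
        rw [Nat.mul_div_cancel' (Nat.dvd_of_mem_divisors hd)]
        split_ifs <;> simp
    _ = ∑ d ∈ Ioc 0 N, ∑ m ∈ Ioc 0 (N / d),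
          (if (d : ℤ) ∣ n then (d : ℝ) * ((d * m : ℕ) : ℝ) ^ (κ - 1) else 0) :=
        sum_Ioc_sum_divisorsAntidiagonal
          (fun d m ↦ if (d : ℤ) ∣ n then (d : ℝ) * ((d * m : ℕ) : ℝ) ^ (κ - 1) else 0) N
    _ ≤ ∑ d ∈ Ioc 0 N, if (d : ℤ) ∣ n then (1 + 1 / κ) * (N : ℝ) ^ κ else 0 := by
        refine sum_le_sum fun d hd ↦ ?_
        rw [mem_Ioc] at hd
        have hd0 : (0 : ℝ) < d := by exact_mod_cast hd.1
        split_ifs with h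
        · have e1 : ∀ m : ℕ, (d : ℝ) * ((d * m : ℕ) : ℝ) ^ (κ - 1) =
              (d : ℝ) ^ κ * (m : ℝ) ^ (κ - 1) := by
            intro m
            push_cast
            rw [Real.mul_rpow hd0.le (by positivity), Real.rpow_sub_one hd0.ne']
            field_simp
          simp_rw [e1]
          rw [← mul_sum]
          calc _ ≤ (d : ℝ) ^ κ * ((1 + 1 / κ) * ((N / d : ℕ) : ℝ) ^ κ) := by
                gcongr
                exact sum_Ioc_rpow_le hκ _
            _ ≤ (d : ℝ) ^ κ * ((1 + 1 / κ) * ((N : ℝ) / d) ^ κ) := by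
                gcongr
                exact Nat.cast_div_le
            _ = _ := by
                rw [Real.div_rpow (by positivity) hd0.le]
                field_simp
        · simp
    _ = ((Ioc 0 N).filter (fun d : ℕ ↦ (d : ℤ) ∣ n)).card * ((1 + 1 / κ) * (N : ℝ) ^ κ) := by
        rw [← sum_filter, sum_const, nsmul_eq_mul]
    _ ≤ tau n.natAbs * ((1 + 1 / κ) * (N : ℝ) ^ κ) := by
        gcongr
        refine card_le_card fun d hd ↦ ?_
        simp only [mem_filter] at hd
        rw [Nat.mem_divisors]
        exact ⟨Int.natCast_dvd.mp hd.2, hn'⟩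
    _ = _ := by ring

end

section

open MeasureTheory Set
open scoped ContDiff

/-! ### Bump functions on the positive half-line -/

/-- `ρ` is smooth and supported in the compact interval `[α, β]` of positive reals. -/
structure IsBump (ρ : ℝ → ℂ) (α β : ℝ) : Prop where
  smooth : ContDiff ℝ ∞ ρ
  pos : 0 < α
  le : α ≤ β
  eq_zero : ∀ x, x ∉ Icc α β → ρ x = 0

namespace IsBump

variable {ρ σ : ℝ → ℂ} {α β : ℝ}

theorem eventually_eq_zero (h : IsBump ρ α β) {x : ℝ} (hx : x ∉ Icc α β) :
    ρ =ᶠ[nhds x] fun _ ↦ 0 := by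
  filter_upwards [isClosed_Icc.isOpen_compl.mem_nhds hx] with y hy
  exact h.eq_zero y hy

theorem hasCompactSupport (h : IsBump ρ α β) : HasCompactSupport ρ :=
  HasCompactSupport.intro isCompact_Icc h.eq_zero

theorem continuous (h : IsBump ρ α β) : Continuous ρ := h.smooth.continuous

theorem hasDerivAt (h : IsBump ρ α β) (x : ℝ) : HasDerivAt ρ (deriv ρ x) x :=
  (h.smooth.differentiable (by simp) x).hasDerivAt

theorem integrable (h : IsBump ρ α β) : Integrable ρ :=
  h.continuous.integrable_of_hasCompactSupport h.hasCompactSupport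

theorem deriv (h : IsBump ρ α β) : IsBump (deriv ρ) α β where
  smooth := (contDiff_infty_iff_deriv.mp h.smooth).2
  pos := h.pos
  le := h.le
  eq_zero x hx := by
    rw [(h.eventually_eq_zero hx).deriv_eq]
    simp

theorem mul_left (h : IsBump ρ α β) {f : ℝ → ℂ} (hf : ContDiffOn ℝ ∞ f (Ioi 0)) :
    IsBump (fun x ↦ f x * ρ x) α β where
  smooth := by
    rw [contDiff_iff_contDiffAt]
    intro x
    rcases lt_or_ge 0 x with hx | hx
    · exact (hf.contDiffAt (Ioi_mem_nhds hx)).mul h.smooth.contDiffAt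
    · have hx' : x ∉ Icc α β := fun hc ↦ (h.pos.trans_le hc.1).not_ge hx
      refine (contDiffAt_const (c := (0 : ℂ))).congr_of_eventuallyEq ?_
      filter_upwards [h.eventually_eq_zero hx'] with y hy
      simp [hy]
  pos := h.pos
  le := h.le
  eq_zero x hx := by simp [h.eq_zero x hx]

theorem add (h : IsBump ρ α β) (h' : IsBump σ α β) : IsBump (fun x ↦ ρ x + σ x) α β where
  smooth := h.smooth.add h'.smooth
  pos := h.pos
  le := h.le
  eq_zero x hx := by simp [h.eq_zero x hx, h'.eq_zero x hx]

theorem exists_bound (h : IsBump ρ α β) : ∃ M, 0 ≤ M ∧ ∀ x, ‖ρ x‖ ≤ M := by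
  obtain ⟨M, hM⟩ := h.continuous.bounded_above_of_compact_support h.hasCompactSupport
  exact ⟨M, (norm_nonneg _).trans (hM 0), hM⟩

theorem mem_Icc_of_ne_zero (h : IsBump ρ α β) {x : ℝ} (hx : ρ x ≠ 0) : x ∈ Icc α β :=
  by_contra fun hc ↦ hx (h.eq_zero x hc)

theorem beta_pos (h : IsBump ρ α β) : 0 < β := h.pos.trans_le h.le

theorem abs_le_sqrt (h : IsBump ρ α β) {u v : ℝ} (hx : ρ (v ^ 2 + u ^ 2) ≠ 0) :
    |v| ≤ √β ∧ |u| ≤ √β := by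
  have := (h.mem_Icc_of_ne_zero hx).2
  constructor <;> apply Real.abs_le_sqrt <;> nlinarith [sq_nonneg u, sq_nonneg v]

theorem eq_zero_of_lt (h : IsBump ρ α β) {u v : ℝ} (hv : √β < |v|) : ρ (v ^ 2 + u ^ 2) = 0 :=
  by_contra fun hc ↦ hv.not_ge (h.abs_le_sqrt hc).1

theorem integral_Ioi (h : IsBump ρ α β) : ∫ x in Ioi (0 : ℝ), ρ x = ∫ x, ρ x := by
  refine setIntegral_eq_integral_of_forall_compl_eq_zero fun x hx ↦ h.eq_zero x fun hc ↦ hx ?_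
  exact h.pos.trans_le hc.1

end IsBump

theorem contDiffOn_ofReal : ContDiffOn ℝ ∞ (fun x : ℝ ↦ (x : ℂ)) (Ioi 0) :=
  Complex.ofRealCLM.contDiff.contDiffOn

theorem norm_integral_le_of_support {f : ℝ → ℂ} {R M : ℝ} (hR : 0 ≤ R)
    (h0 : ∀ v, R < |v| → f v = 0) (hM : ∀ v, ‖f v‖ ≤ M) : ‖∫ v, f v‖ ≤ 2 * R * M := by
  have h1 : ∫ v, f v = ∫ v in Icc (-R) R, f v := by
    symm
    refine setIntegral_eq_integral_of_forall_compl_eq_zero fun x hx ↦ h0 x ?_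
    by_contra hc
    exact hx (abs_le.mp (not_lt.mp hc))
  rw [h1]
  refine (norm_setIntegral_le_of_norm_le_const (C := M) (by simp) fun x _ ↦ hM x).trans ?_
  rw [Measure.real, Real.volume_Icc, ENNReal.toReal_ofReal (by linarith)]
  exact le_of_eq (by ring)

/-! ### The weight factor as a function on the upper half plane -/

/-- The weight factor `(w / |w|)^{-k}` at `w = v + i u`, that is `exp(-i k θ)` for `θ = arg w`. -/
noncomputable def twist (k : ℤ) (u v : ℝ) : ℂ :=
  (((v : ℂ) + u * Complex.I) / (‖(v : ℂ) + u * Complex.I‖ : ℂ)) ^ (-k)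

theorem add_mul_I_ne_zero {u : ℝ} (hu : 0 < u) (v : ℝ) : (v : ℂ) + u * Complex.I ≠ 0 := by
  intro h
  have := congrArg Complex.im h
  simp at this
  exact hu.ne' this

theorem sub_mul_I_ne_zero {u : ℝ} (hu : 0 < u) (v : ℝ) : (v : ℂ) - u * Complex.I ≠ 0 := by
  intro h
  have := congrArg Complex.im h
  simp at this
  exact hu.ne' this

theorem norm_twist (k : ℤ) {u : ℝ} (hu : 0 < u) (v : ℝ) : ‖twist k u v‖ = 1 := by
  have h : ‖(v : ℂ) + u * Complex.I‖ ≠ 0 := norm_ne_zero_iff.mpr (add_mul_I_ne_zero hu v)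
  rw [twist, norm_zpow, norm_div, Complex.norm_real, norm_norm, div_self h, one_zpow]

theorem twist_mul (k : ℤ) {s : ℝ} (hs : 0 < s) (u v : ℝ) : twist k (s * u) (s * v) = twist k u v := by
  have h : ((s * v : ℝ) : ℂ) + ((s * u : ℝ) : ℂ) * Complex.I = (s : ℂ) * (v + u * Complex.I) := by
    push_cast
    ring
  have hs' : (s : ℂ) ≠ 0 := by exact_mod_cast hs.ne'
  rw [twist, twist, h, norm_mul, Complex.norm_real, Real.norm_of_nonneg hs.le]
  push_cast
  rw [mul_div_mul_left _ _ hs']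

theorem twist_zero {u : ℝ} (v : ℝ) : twist 0 u v = 1 := by simp [twist]

/-- For even weight the modulus disappears, so that `twist` is a rational function of `v`. -/
theorem twist_eq_div {l : ℤ} {u : ℝ} (hu : 0 < u) (v : ℝ) :
    twist (l + l) u v = (((v : ℂ) + u * Complex.I) / ((v : ℂ) - u * Complex.I)) ^ (-l) := by
  have h := add_mul_I_ne_zero hu v
  have h' := sub_mul_I_ne_zero hu v
  have hn : (‖(v : ℂ) + u * Complex.I‖ : ℂ) ^ 2 =
      ((v : ℂ) + u * Complex.I) * ((v : ℂ) - u * Complex.I) := by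
    rw [← Complex.conj_mul']
    simp
    ring
  rw [twist, show -(l + l) = 2 * (-l) by ring, zpow_mul]
  congr 1
  rw [show (2 : ℤ) = ((2 : ℕ) : ℤ) by rfl, zpow_natCast, div_pow, hn]
  field_simp

theorem hasDerivAt_twist {k : ℤ} (hk : Even k) {u : ℝ} (hu : 0 < u) (v : ℝ) :
    HasDerivAt (twist k u) (Complex.I * k * u / ((v ^ 2 + u ^ 2 : ℝ) : ℂ) * twist k u v) v := by
  obtain ⟨l, rfl⟩ := hk
  have h := add_mul_I_ne_zero hu v
  have h' := sub_mul_I_ne_zero hu v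
  have h1 : HasDerivAt (fun v : ℝ ↦ (v : ℂ) + u * Complex.I) 1 v :=
    (Complex.ofRealCLM.hasDerivAt (x := v)).add_const _
  have h2 : HasDerivAt (fun v : ℝ ↦ (v : ℂ) - u * Complex.I) 1 v :=
    (Complex.ofRealCLM.hasDerivAt (x := v)).sub_const _
  have h3 := h1.div h2 h'
  have h4 := (hasDerivAt_zpow (-l) (((v : ℂ) + u * Complex.I) / ((v : ℂ) - u * Complex.I))
    (Or.inl (div_ne_zero h h'))).comp v h3
  have he : twist (l + l) u = (fun x ↦ x ^ (-l)) ∘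
      ((fun v : ℝ ↦ (v : ℂ) + u * Complex.I) / (fun v : ℝ ↦ (v : ℂ) - u * Complex.I)) := by
    ext w
    exact twist_eq_div hu w
  rw [he]
  refine h4.congr_deriv ?_
  have hr : ((v ^ 2 + u ^ 2 : ℝ) : ℂ) = ((v : ℂ) + u * Complex.I) * ((v : ℂ) - u * Complex.I) := by
    push_cast
    linear_combination ((u : ℂ) ^ 2) * Complex.I_sq
  rw [hr]
  simp only [Function.comp_apply, Pi.div_apply]
  rw [zpow_sub_one₀ (div_ne_zero h h')]
  push_cast
  field_simp
  ring

theorem continuous_twist {k : ℤ} (hk : Even k) {u : ℝ} (hu : 0 < u) : Continuous (twist k u) :=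
  continuous_iff_continuousAt.mpr fun v ↦ (hasDerivAt_twist hk hu v).continuousAt

/-- Integration by parts against the weight factor, whose logarithmic derivative in `v` is
`i k u / (v² + u²)`. -/
theorem integral_twist_by_parts {k : ℤ} (hk : Even k) {u : ℝ} (hu : 0 < u) {p p' : ℝ → ℂ} {R : ℝ}
    (hp : ∀ v, HasDerivAt p (p' v) v) (hp' : Continuous p') (h0 : ∀ v, R < |v| → p v = 0) :
    ∫ v, (p' v + Complex.I * k * u / ((v ^ 2 + u ^ 2 : ℝ) : ℂ) * p v) * twist k u v = 0 := by
  have hcs : HasCompactSupport p := by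
    refine HasCompactSupport.intro (isCompact_Icc (a := -R) (b := R)) fun x hx ↦ h0 x ?_
    by_contra hc
    exact hx (abs_le.mp (not_lt.mp hc))
  have hcs' : HasCompactSupport p' := by
    have : p' = deriv p := by ext v; exact (hp v).deriv.symm
    rw [this]
    exact hcs.deriv
  have hpc : Continuous p := continuous_iff_continuousAt.mpr fun v ↦ (hp v).continuousAt
  have ht := continuous_twist hk hu
  have hne : ∀ v : ℝ, ((v ^ 2 + u ^ 2 : ℝ) : ℂ) ≠ 0 := by
    intro v
    exact_mod_cast (by positivity : v ^ 2 + u ^ 2 ≠ 0)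
  have hq : Continuous fun v : ℝ ↦ Complex.I * k * u / ((v ^ 2 + u ^ 2 : ℝ) : ℂ) := by
    refine Continuous.div (by fun_prop) (by fun_prop) hne
  refine integral_eq_zero_of_hasDerivAt_of_integrable (f := fun v ↦ p v * twist k u v)
    (fun v ↦ ?_) ?_ ?_
  · refine ((hp v).mul (hasDerivAt_twist hk hu v)).congr_deriv ?_
    ring
  · refine Continuous.integrable_of_hasCompactSupport (by fun_prop) ?_
    exact (hcs'.add (hcs.mul_left)).mul_right
  · exact Continuous.integrable_of_hasCompactSupport (by fun_prop) hcs.mul_right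

/-! ### Oscillatory integrals -/

/-- The oscillatory integral `∫ v^i u^j ρ(v² + u²) exp(-i k θ) e(-ξ v) dv`, where
`v + i u = r exp(i θ)`. -/
noncomputable def oscInt (i j : ℕ) (ρ : ℝ → ℂ) (k : ℤ) (u ξ : ℝ) : ℂ :=
  ∫ v : ℝ, (v : ℂ) ^ i * (u : ℂ) ^ j * ρ (v ^ 2 + u ^ 2) * twist k u v * e (-(v * ξ))

theorem hasDerivAt_e_neg_mul (ξ v : ℝ) :
    HasDerivAt (fun v : ℝ ↦ e (-(v * ξ))) (-(2 * Real.pi * Complex.I * ξ) * e (-(v * ξ))) v := by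
  have h1 : HasDerivAt (fun v : ℝ ↦ 2 * Real.pi * Complex.I * ((-(v * ξ) : ℝ) : ℂ))
      (-(2 * Real.pi * Complex.I * ξ)) v := by
    have := ((Complex.ofRealCLM.hasDerivAt (x := v)).const_mul (-(2 * Real.pi * Complex.I * ξ)))
    simp only [Complex.ofRealCLM_apply, Complex.ofReal_one, mul_one] at this
    refine this.congr_of_eventuallyEq (Filter.Eventually.of_forall fun w ↦ ?_)
    push_cast
    ring
  refine (h1.cexp).congr_deriv ?_
  rw [e]
  ring

theorem continuous_e : Continuous e := by
  unfold e
  fun_prop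

theorem IsBump.hasDerivAt_comp {ρ : ℝ → ℂ} {α β : ℝ} (h : IsBump ρ α β) (u v : ℝ) :
    HasDerivAt (fun v : ℝ ↦ ρ (v ^ 2 + u ^ 2)) (2 * v * _root_.deriv ρ (v ^ 2 + u ^ 2)) v := by
  have h1 : HasDerivAt (fun v : ℝ ↦ v ^ 2 + u ^ 2) (2 * v) v := by
    simpa using (hasDerivAt_pow 2 v).add_const (u ^ 2)
  refine ((h.hasDerivAt (v ^ 2 + u ^ 2)).scomp v h1).congr_deriv ?_
  rw [Complex.real_smul]
  push_cast
  ring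

theorem norm_oscInt_le {ρ : ℝ → ℂ} {α β M : ℝ} (h : IsBump ρ α β) (hM : ∀ x, ‖ρ x‖ ≤ M)
    (i j : ℕ) (k : ℤ) {u : ℝ} (hu : 0 < u) (ξ : ℝ) :
    ‖oscInt i j ρ k u ξ‖ ≤ 2 * √β * (√β ^ (i + j) * M) := by
  have hM0 : 0 ≤ M := (norm_nonneg _).trans (hM 0)
  refine norm_integral_le_of_support (Real.sqrt_nonneg β) (fun v hv ↦ ?_) fun v ↦ ?_
  · simp [h.eq_zero_of_lt hv]
  · rw [norm_mul, norm_mul, norm_e, norm_twist k hu, mul_one, mul_one, norm_mul, norm_mul, norm_pow,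
      norm_pow, Complex.norm_real, Complex.norm_real, Real.norm_eq_abs, Real.norm_eq_abs]
    by_cases hρ : ρ (v ^ 2 + u ^ 2) = 0
    · rw [hρ, norm_zero, mul_zero]
      positivity
    · obtain ⟨h1, h2⟩ := h.abs_le_sqrt hρ
      rw [pow_add]
      gcongr
      exact hM _

theorem oscInt_integrable {ρ : ℝ → ℂ} {α β : ℝ} (h : IsBump ρ α β) (i j : ℕ) {k : ℤ} (hk : Even k)
    {u : ℝ} (hu : 0 < u) (ξ : ℝ) : Integrable fun v : ℝ ↦
      (v : ℂ) ^ i * (u : ℂ) ^ j * ρ (v ^ 2 + u ^ 2) * twist k u v * e (-(v * ξ)) := by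
  have ht := continuous_twist hk hu
  have he := continuous_e
  have hρ := h.continuous
  refine Continuous.integrable_of_hasCompactSupport (by fun_prop) ?_
  refine HasCompactSupport.intro (isCompact_Icc (a := -√β) (b := √β)) fun v hv ↦ ?_
  have : √β < |v| := by
    by_contra hc
    exact hv (abs_le.mp (not_lt.mp hc))
  simp [h.eq_zero_of_lt this]

theorem integral_sub_add_add {f₁ f₂ f₃ f₄ : ℝ → ℂ} (h₁ : Integrable f₁) (h₂ : Integrable f₂)
    (h₃ : Integrable f₃) (h₄ : Integrable f₄) :
    (∫ v, f₁ v) - ((∫ v, f₂ v) + (∫ v, f₃ v) + ∫ v, f₄ v) = ∫ v, (f₁ v - (f₂ v + f₃ v + f₄ v)) := by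
  rw [integral_sub (g := fun v ↦ f₂ v + f₃ v + f₄ v) h₁ ((h₂.add h₃).add h₄),
    integral_add (f := fun v ↦ f₂ v + f₃ v) (h₂.add h₃) h₄, integral_add h₂ h₃]

/-- One integration by parts in `v`: the right-hand side has the same shape, with one factor `k` and no
factor `ξ`. For `i = 0` the term with `i - 1` has coefficient zero. -/
theorem oscInt_by_parts {ρ : ℝ → ℂ} {α β : ℝ} (h : IsBump ρ α β) (i j : ℕ) {k : ℤ} (hk : Even k)
    {u : ℝ} (hu : 0 < u) (ξ : ℝ) :
    2 * Real.pi * Complex.I * ξ * oscInt i j ρ k u ξ =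
      i * oscInt (i - 1) j ρ k u ξ + 2 * oscInt (i + 1) j (deriv ρ) k u ξ +
        Complex.I * k * oscInt i (j + 1) (fun x ↦ (x : ℂ)⁻¹ * ρ x) k u ξ := by
  have he := continuous_e
  have hρ := h.continuous
  have hρ' := h.deriv.continuous
  have hx : IsBump (fun x ↦ (x : ℂ)⁻¹ * ρ x) α β := h.mul_left
    (contDiffOn_ofReal.inv fun x hx ↦ by
      exact_mod_cast (ne_of_gt hx))
  have hd : ∀ v : ℝ, HasDerivAt
      (fun v : ℝ ↦ (v : ℂ) ^ i * (u : ℂ) ^ j * ρ (v ^ 2 + u ^ 2) * e (-(v * ξ)))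
      ((i * (v : ℂ) ^ (i - 1) * (u : ℂ) ^ j * ρ (v ^ 2 + u ^ 2) +
          2 * ((v : ℂ) ^ (i + 1) * (u : ℂ) ^ j * deriv ρ (v ^ 2 + u ^ 2)) -
          2 * Real.pi * Complex.I * ξ * ((v : ℂ) ^ i * (u : ℂ) ^ j * ρ (v ^ 2 + u ^ 2))) *
        e (-(v * ξ))) v := by
    intro v
    have h1 : HasDerivAt (fun v : ℝ ↦ (v : ℂ) ^ i) (i * (v : ℂ) ^ (i - 1)) v := by
      simpa using (Complex.ofRealCLM.hasDerivAt (x := v)).fun_pow i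
    refine (((h1.mul_const ((u : ℂ) ^ j)).mul (h.hasDerivAt_comp u v)).mul
      (hasDerivAt_e_neg_mul ξ v)).congr_deriv ?_
    simp only [Pi.mul_apply]
    ring
  have key := integral_twist_by_parts hk hu (R := √β) hd (by fun_prop)
    (fun v hv ↦ by simp [h.eq_zero_of_lt hv])
  have i1 := (oscInt_integrable h i j hk hu ξ).const_mul (2 * Real.pi * Complex.I * ξ)
  have i2 := (oscInt_integrable h (i - 1) j hk hu ξ).const_mul (i : ℂ)
  have i3 := (oscInt_integrable h.deriv (i + 1) j hk hu ξ).const_mul 2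
  have i4 := (oscInt_integrable hx i (j + 1) hk hu ξ).const_mul (Complex.I * k)
  simp only [oscInt]
  rw [← integral_const_mul, ← integral_const_mul, ← integral_const_mul, ← integral_const_mul,
    ← sub_eq_zero, integral_sub_add_add i1 i2 i3 i4, ← neg_eq_zero, ← integral_neg, ← key]
  refine integral_congr_ae (Filter.Eventually.of_forall fun v ↦ ?_)
  ring

/-- Repeated integration by parts: each step costs a factor `max 1 |k|` and gains `1 / |ξ|`,
uniformly in `u`. -/
theorem exists_norm_oscInt_le_pow (A : ℕ) : ∀ (i j : ℕ) (ρ : ℝ → ℂ) (α β : ℝ), IsBump ρ α β →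
    ∃ C : ℝ, 0 ≤ C ∧ ∀ (k : ℤ), Even k → ∀ u : ℝ, 0 < u → ∀ ξ : ℝ, ξ ≠ 0 →
      ‖oscInt i j ρ k u ξ‖ ≤ C * (max 1 (k.natAbs : ℝ) / |ξ|) ^ A := by
  induction A with
  | zero =>
    intro i j ρ α β h
    obtain ⟨M, hM0, hM⟩ := h.exists_bound
    exact ⟨2 * √β * (√β ^ (i + j) * M), by positivity,
      fun k _ u hu ξ _ ↦ by simpa using norm_oscInt_le h hM i j k hu ξ⟩
  | succ A ih =>
    intro i j ρ α β h
    have hx : IsBump (fun x ↦ (x : ℂ)⁻¹ * ρ x) α β := h.mul_left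
      (contDiffOn_ofReal.inv fun x hx ↦ by exact_mod_cast (ne_of_gt hx))
    obtain ⟨C1, h1, H1⟩ := ih (i - 1) j ρ α β h
    obtain ⟨C2, h2, H2⟩ := ih (i + 1) j _ α β h.deriv
    obtain ⟨C3, h3, H3⟩ := ih i (j + 1) _ α β hx
    refine ⟨i * C1 + 2 * C2 + C3, by positivity, fun k hk u hu ξ hξ ↦ ?_⟩
    have hξ' : 0 < |ξ| := abs_pos.mpr hξ
    set K := max 1 (k.natAbs : ℝ) with hK
    have hK1 : 1 ≤ K := le_max_left _ _
    have hk' : ‖(k : ℂ)‖ ≤ K := by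
      rw [Complex.norm_intCast, ← Int.cast_abs, ← Nat.cast_natAbs]
      exact le_max_right _ _
    have hb := congrArg norm (oscInt_by_parts h i j hk hu ξ)
    have hl : ‖2 * Real.pi * Complex.I * ξ * oscInt i j ρ k u ξ‖ =
        2 * Real.pi * |ξ| * ‖oscInt i j ρ k u ξ‖ := by
      simp [abs_of_pos Real.pi_pos]
    rw [hl] at hb
    have hr : 2 * Real.pi * |ξ| * ‖oscInt i j ρ k u ξ‖ ≤
        (i * C1 + 2 * C2 + C3) * K * (K / |ξ|) ^ A := by
      rw [hb]
      refine (norm_add₃_le).trans ?_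
      rw [norm_mul, norm_mul, norm_mul, norm_mul, Complex.norm_I, one_mul, Complex.norm_natCast,
        Complex.norm_ofNat]
      calc _ ≤ i * (C1 * (K / |ξ|) ^ A) + 2 * (C2 * (K / |ξ|) ^ A) + K * (C3 * (K / |ξ|) ^ A) := by
            gcongr
            · exact H1 k hk u hu ξ hξ
            · exact H2 k hk u hu ξ hξ
            · exact H3 k hk u hu ξ hξ
        _ = (i * C1 * 1 + 2 * C2 * 1 + C3 * K) * (K / |ξ|) ^ A := by ring
        _ ≤ (i * C1 * K + 2 * C2 * K + C3 * K) * (K / |ξ|) ^ A := by gcongr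
        _ = _ := by ring
    have hpi : 1 ≤ 2 * Real.pi := by linarith [Real.pi_gt_three]
    have : |ξ| * ‖oscInt i j ρ k u ξ‖ ≤ (i * C1 + 2 * C2 + C3) * K * (K / |ξ|) ^ A := by
      refine le_trans ?_ hr
      rw [mul_assoc]
      exact le_mul_of_one_le_left (by positivity) hpi
    calc ‖oscInt i j ρ k u ξ‖ ≤ (i * C1 + 2 * C2 + C3) * K * (K / |ξ|) ^ A / |ξ| := by
          rw [le_div_iff₀ hξ', mul_comm]
          exact this
      _ = _ := by rw [pow_succ]; ring

/-- Interpolation of the bounds of `exists_norm_oscInt_le_pow` for the exponents `0` and `1`. -/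
theorem exists_norm_oscInt_le_rpow {ρ : ℝ → ℂ} {α β : ℝ} (h : IsBump ρ α β) {κ : ℝ} (h0 : 0 ≤ κ)
    (h1 : κ ≤ 1) : ∃ C : ℝ, 0 ≤ C ∧ ∀ (k : ℤ), Even k → ∀ u : ℝ, 0 < u → ∀ ξ : ℝ, ξ ≠ 0 →
      ‖oscInt 0 0 ρ k u ξ‖ ≤ C * (max 1 (k.natAbs : ℝ) / |ξ|) ^ κ := by
  obtain ⟨C0, hC0, H0⟩ := exists_norm_oscInt_le_pow 0 0 0 ρ α β h
  obtain ⟨C1, hC1, H1⟩ := exists_norm_oscInt_le_pow 1 0 0 ρ α β h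
  refine ⟨C0 + C1, by positivity, fun k hk u hu ξ hξ ↦ ?_⟩
  have hξ' : 0 < |ξ| := abs_pos.mpr hξ
  set x := max 1 (k.natAbs : ℝ) / |ξ| with hx
  have hx0 : 0 < x := by positivity
  rcases le_total 1 x with hx1 | hx1
  · have h2 := H0 k hk u hu ξ hξ
    rw [pow_zero, mul_one] at h2
    have h3 : 1 ≤ x ^ κ := Real.one_le_rpow hx1 h0
    nlinarith
  · have h2 := H1 k hk u hu ξ hξ
    rw [pow_one] at h2
    have h3 : x ≤ x ^ κ := by
      simpa using Real.rpow_le_rpow_of_exponent_ge hx0 hx1 h1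
    calc _ ≤ C1 * x := h2
      _ ≤ C1 * x ^ κ := by gcongr
      _ ≤ _ := by gcongr; linarith

end

section

open MeasureTheory Set
open scoped ContDiff

/-! ### The zero frequency integral -/

/-- The integral `∫ ρ(v² + u²) exp(-i k θ) dv` over the horizontal line at height `u`. -/
noncomputable def lineInt (ρ : ℝ → ℂ) (k : ℤ) (u : ℝ) : ℂ :=
  ∫ v : ℝ, ρ (v ^ 2 + u ^ 2) * twist k u v

/-- The Euler operator `ρ ↦ ρ + 2 x ρ'`, which describes the action of `u d/du` on `lineInt`. -/
noncomputable def euler (ρ : ℝ → ℂ) (x : ℝ) : ℂ := ρ x + 2 * x * deriv ρ x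

/-- The bump function `2 x ρ'`, for which `euler ρ = ρ + eulerTail ρ`. -/
noncomputable def eulerTail (ρ : ℝ → ℂ) (x : ℝ) : ℂ := 2 * x * deriv ρ x

variable {ρ σ : ℝ → ℂ} {α β : ℝ}

theorem IsBump.eulerTail (h : IsBump ρ α β) : IsBump (eulerTail ρ) α β :=
  h.deriv.mul_left (contDiffOn_const.mul contDiffOn_ofReal)

theorem IsBump.euler (h : IsBump ρ α β) : IsBump (euler ρ) α β := h.add h.eulerTail

theorem oscInt_zero_zero (ρ : ℝ → ℂ) (k : ℤ) (u : ℝ) : oscInt 0 0 ρ k u 0 = lineInt ρ k u := by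
  simp [oscInt, lineInt, e_zero]

theorem IsBump.integrable_line (h : IsBump ρ α β) {k : ℤ} (hk : Even k) {u : ℝ} (hu : 0 < u) :
    Integrable fun v : ℝ ↦ ρ (v ^ 2 + u ^ 2) * twist k u v := by
  simpa [e_zero] using oscInt_integrable h 0 0 hk hu 0

theorem lineInt_add (h : IsBump ρ α β) (h' : IsBump σ α β) {k : ℤ} (hk : Even k) {u : ℝ}
    (hu : 0 < u) : lineInt (fun x ↦ ρ x + σ x) k u = lineInt ρ k u + lineInt σ k u := by
  simp only [lineInt, add_mul]
  exact integral_add (h.integrable_line hk hu) (h'.integrable_line hk hu)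

theorem lineInt_eq_zero (h : IsBump ρ α β) (k : ℤ) {u : ℝ} (hu : √β < u) : lineInt ρ k u = 0 := by
  have : ∀ v : ℝ, ρ (v ^ 2 + u ^ 2) = 0 := fun v ↦
    by_contra fun hc ↦ (hu.trans_le (le_abs_self u)).not_ge (h.abs_le_sqrt hc).2
  simp [lineInt, this]

theorem exists_norm_lineInt_le (h : IsBump ρ α β) :
    ∃ C : ℝ, 0 ≤ C ∧ ∀ (k : ℤ) (u : ℝ), 0 < u → ‖lineInt ρ k u‖ ≤ C := by
  obtain ⟨M, hM0, hM⟩ := h.exists_bound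
  exact ⟨2 * √β * (√β ^ (0 + 0) * M), by positivity, fun k u hu ↦ by
    rw [← oscInt_zero_zero]
    exact norm_oscInt_le h hM 0 0 k hu 0⟩

/-- Decay of `lineInt` for large `|k| u`, by one integration by parts. -/
theorem exists_norm_lineInt_mul_le (h : IsBump ρ α β) :
    ∃ C : ℝ, 0 ≤ C ∧ ∀ k : ℤ, Even k → ∀ u : ℝ, 0 < u →
      (k.natAbs : ℝ) * u * ‖lineInt ρ k u‖ ≤ C := by
  have hq : IsBump (fun x ↦ (x : ℂ) * ρ x) α β := h.mul_left contDiffOn_ofReal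
  obtain ⟨M, hM0, hM⟩ := hq.deriv.exists_bound
  refine ⟨2 * √β * (2 * √β * M), by positivity, fun k hk u hu ↦ ?_⟩
  have key := integral_twist_by_parts hk hu (R := √β) (hq.hasDerivAt_comp u)
    (by have := hq.deriv.continuous; fun_prop) (fun v hv ↦ hq.eq_zero_of_lt hv)
  have hne : ∀ v : ℝ, ((v ^ 2 + u ^ 2 : ℝ) : ℂ) ≠ 0 := by
    intro v
    exact_mod_cast (by positivity : v ^ 2 + u ^ 2 ≠ 0)
  have ht := continuous_twist hk hu
  have hsupp : HasCompactSupport fun v : ℝ ↦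
      2 * (v : ℂ) * deriv (fun x : ℝ ↦ (x : ℂ) * ρ x) (v ^ 2 + u ^ 2) * twist k u v := by
    refine HasCompactSupport.intro (isCompact_Icc (a := -√β) (b := √β)) fun v hv ↦ ?_
    have : √β < |v| := by
      by_contra hc
      exact hv (abs_le.mp (not_lt.mp hc))
    simp [hq.deriv.eq_zero_of_lt this]
  have i1 : Integrable fun v : ℝ ↦
      2 * (v : ℂ) * deriv (fun x : ℝ ↦ (x : ℂ) * ρ x) (v ^ 2 + u ^ 2) * twist k u v :=
    Continuous.integrable_of_hasCompactSupport
      (by have := hq.deriv.continuous; fun_prop) hsupp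
  have e1 : Complex.I * k * u * lineInt ρ k u =
      -∫ v : ℝ, 2 * (v : ℂ) * deriv (fun x : ℝ ↦ (x : ℂ) * ρ x) (v ^ 2 + u ^ 2) * twist k u v := by
    rw [eq_neg_iff_add_eq_zero, lineInt, ← integral_const_mul,
      ← integral_add ((h.integrable_line hk hu).const_mul _) i1, ← key]
    refine integral_congr_ae (Filter.Eventually.of_forall fun v ↦ ?_)
    have := hne v
    field_simp
    ring
  have e2 := congrArg norm e1
  rw [norm_neg, norm_mul, norm_mul, norm_mul, Complex.norm_I, one_mul, Complex.norm_intCast,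
    Complex.norm_real, Real.norm_of_nonneg hu.le, ← Int.cast_abs, ← Nat.cast_natAbs] at e2
  rw [e2]
  refine norm_integral_le_of_support (Real.sqrt_nonneg β)
    (fun v hv ↦ by simp [hq.deriv.eq_zero_of_lt hv]) fun v ↦ ?_
  rw [norm_mul, norm_twist k hu, mul_one, norm_mul, norm_mul, Complex.norm_ofNat,
    Complex.norm_real, Real.norm_eq_abs]
  by_cases hz : deriv (fun x : ℝ ↦ (x : ℂ) * ρ x) (v ^ 2 + u ^ 2) = 0
  · rw [hz, norm_zero, mul_zero]
    positivity
  · have := (hq.deriv.abs_le_sqrt hz).1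
    gcongr
    exact hM _

/-- The integral of `euler σ` is small for small `u`: its integrand is the `v`-derivative of
`v σ(v² + u²)` up to terms of size `O(u)`. -/
theorem exists_norm_lineInt_euler_le (h : IsBump σ α β) :
    ∃ C : ℝ, 0 ≤ C ∧ ∀ k : ℤ, Even k → ∀ u : ℝ, 0 < u →
      ‖lineInt (euler σ) k u‖ ≤ C * max 1 (k.natAbs : ℝ) * u := by
  obtain ⟨M, hM0, hM⟩ := h.exists_bound
  obtain ⟨M', hM'0, hM'⟩ := h.deriv.exists_bound
  have hβ := Real.sqrt_nonneg β
  have hα := h.pos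
  refine ⟨2 * √β * (2 * √β * M' + √β * M / α), by positivity, fun k hk u hu ↦ ?_⟩
  set K := max 1 (k.natAbs : ℝ) with hK
  have hK1 : 1 ≤ K := le_max_left _ _
  have hk' : ‖(k : ℂ)‖ ≤ K := by
    rw [Complex.norm_intCast, ← Int.cast_abs, ← Nat.cast_natAbs]
    exact le_max_right _ _
  have hd : ∀ v : ℝ, HasDerivAt (fun v : ℝ ↦ (v : ℂ) * σ (v ^ 2 + u ^ 2))
      (σ (v ^ 2 + u ^ 2) + 2 * v ^ 2 * deriv σ (v ^ 2 + u ^ 2)) v := by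
    intro v
    refine ((Complex.ofRealCLM.hasDerivAt (x := v)).mul (h.hasDerivAt_comp u v)).congr_deriv ?_
    simp
    ring
  have hc := h.continuous
  have hc' := h.deriv.continuous
  have ht := continuous_twist hk hu
  have key := integral_twist_by_parts hk hu (R := √β) hd (by fun_prop)
    (fun v hv ↦ by simp [h.eq_zero_of_lt hv])
  have hne : ∀ v : ℝ, ((v ^ 2 + u ^ 2 : ℝ) : ℂ) ≠ 0 := by
    intro v
    exact_mod_cast (by positivity : v ^ 2 + u ^ 2 ≠ 0)
  have i2 : Integrable fun v : ℝ ↦ (σ (v ^ 2 + u ^ 2) + 2 * v ^ 2 * deriv σ (v ^ 2 + u ^ 2) +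
      Complex.I * k * u / ((v ^ 2 + u ^ 2 : ℝ) : ℂ) * (v * σ (v ^ 2 + u ^ 2))) * twist k u v := by
    have hq : Continuous fun v : ℝ ↦ Complex.I * k * u / ((v ^ 2 + u ^ 2 : ℝ) : ℂ) :=
      Continuous.div (by fun_prop) (by fun_prop) hne
    refine Continuous.integrable_of_hasCompactSupport (by fun_prop) ?_
    refine HasCompactSupport.intro (isCompact_Icc (a := -√β) (b := √β)) fun v hv ↦ ?_
    have : √β < |v| := by
      by_contra hc
      exact hv (abs_le.mp (not_lt.mp hc))
    simp [h.eq_zero_of_lt this, h.deriv.eq_zero_of_lt this]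
  have e1 : lineInt (euler σ) k u = ∫ v : ℝ, (2 * u ^ 2 * deriv σ (v ^ 2 + u ^ 2) -
      Complex.I * k * u / ((v ^ 2 + u ^ 2 : ℝ) : ℂ) * (v * σ (v ^ 2 + u ^ 2))) * twist k u v := by
    rw [← sub_zero (lineInt (euler σ) k u), ← key, lineInt,
      ← integral_sub (h.euler.integrable_line hk hu) i2]
    refine integral_congr_ae (Filter.Eventually.of_forall fun v ↦ ?_)
    simp only [euler]
    push_cast
    ring
  rw [e1]
  have hbound : ∀ v : ℝ, ‖(2 * u ^ 2 * deriv σ (v ^ 2 + u ^ 2) -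
      Complex.I * k * u / ((v ^ 2 + u ^ 2 : ℝ) : ℂ) * (v * σ (v ^ 2 + u ^ 2))) * twist k u v‖ ≤
      (2 * √β * M' + √β * M / α) * K * u := by
    intro v
    rw [norm_mul, norm_twist k hu, mul_one]
    refine (norm_sub_le _ _).trans ?_
    have b1 : ‖2 * (u : ℂ) ^ 2 * deriv σ (v ^ 2 + u ^ 2)‖ ≤ 2 * √β * M' * K * u := by
      rw [norm_mul, norm_mul, norm_pow, Complex.norm_ofNat, Complex.norm_real,
        Real.norm_of_nonneg hu.le]
      by_cases hz : deriv σ (v ^ 2 + u ^ 2) = 0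
      · rw [hz, norm_zero, mul_zero]
        positivity
      · have h2 := (h.deriv.abs_le_sqrt hz).2
        rw [abs_of_pos hu] at h2
        calc 2 * u ^ 2 * ‖deriv σ (v ^ 2 + u ^ 2)‖ ≤ 2 * (√β * u) * M' := by
              rw [sq]
              gcongr
              exact hM' _
          _ = 2 * √β * M' * 1 * u := by ring
          _ ≤ _ := by gcongr
    have b2 : ‖Complex.I * k * u / ((v ^ 2 + u ^ 2 : ℝ) : ℂ) * (v * σ (v ^ 2 + u ^ 2))‖ ≤
        √β * M / α * K * u := by
      by_cases hz : σ (v ^ 2 + u ^ 2) = 0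
      · rw [hz, mul_zero, mul_zero, norm_zero]
        positivity
      · have h2 := (h.abs_le_sqrt hz).1
        have h3 := (h.mem_Icc_of_ne_zero hz).1
        rw [norm_mul, norm_div, norm_mul, norm_mul, norm_mul, Complex.norm_I, one_mul,
          Complex.norm_real, Complex.norm_real, Complex.norm_real, Real.norm_of_nonneg hu.le,
          Real.norm_of_nonneg (by positivity : 0 ≤ v ^ 2 + u ^ 2), Real.norm_eq_abs]
        calc _ ≤ K * u / α * (√β * M) := by
              gcongr
              exact hM _
          _ = _ := by ring
    linarith
  refine (norm_integral_le_of_support hβ (fun v hv ↦ ?_) hbound).trans (le_of_eq (by ring))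
  simp [h.eq_zero_of_lt hv, h.deriv.eq_zero_of_lt hv]

/-- With `K = max 1 |k|`, the integral of `euler σ` is `O(min(K u, 1 / (K u)))`. -/
theorem exists_norm_lineInt_euler_le_div (h : IsBump σ α β) :
    ∃ C : ℝ, 0 ≤ C ∧ ∀ k : ℤ, Even k → ∀ u : ℝ, 0 < u → ‖lineInt (euler σ) k u‖ ≤
      C * (max 1 (k.natAbs : ℝ) * u / (1 + (max 1 (k.natAbs : ℝ) * u) ^ 2)) := by
  obtain ⟨C1, hC1, H1⟩ := exists_norm_lineInt_euler_le h
  obtain ⟨C2, hC2, H2⟩ := exists_norm_lineInt_mul_le h.euler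
  have hβ := h.beta_pos
  refine ⟨C1 + C2 + C1 * β, by positivity, fun k hk u hu ↦ ?_⟩
  have h1 := H1 k hk u hu
  have h2 := H2 k hk u hu
  rw [← mul_div_assoc, le_div_iff₀ (by positivity)]
  rcases eq_or_ne k 0 with rfl | hk0
  · simp only [Int.natAbs_zero, Nat.cast_zero, zero_le_one, sup_of_le_left, mul_one] at h1 ⊢
    rcases lt_or_ge √β u with hu' | hu'
    · rw [lineInt_eq_zero h.euler 0 hu', norm_zero, zero_mul]
      positivity
    · have hu2 : u ^ 2 ≤ β := by
        rw [← Real.sq_sqrt hβ.le]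
        gcongr
      calc _ ≤ (C1 * u) * (1 + (1 * u) ^ 2) := by gcongr
        _ ≤ (C1 * u) * (1 + β) := by
            rw [one_mul]
            gcongr
        _ ≤ _ := by nlinarith [mul_nonneg hC2 hu.le]
  · have hK : max 1 (k.natAbs : ℝ) = k.natAbs :=
      max_eq_right (by exact_mod_cast Int.natAbs_pos.mpr hk0)
    have hk1 : (1 : ℝ) ≤ k.natAbs := by exact_mod_cast Int.natAbs_pos.mpr hk0
    rw [hK] at h1 ⊢
    set K : ℝ := (k.natAbs : ℝ)
    calc ‖lineInt (euler σ) k u‖ * (1 + (K * u) ^ 2)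
        = ‖lineInt (euler σ) k u‖ + (K * u) * (K * u * ‖lineInt (euler σ) k u‖) := by ring
      _ ≤ C1 * K * u + (K * u) * C2 := by gcongr
      _ ≤ _ := by
        have : 0 ≤ C1 * β * (K * u) := by positivity
        linarith

/-! ### Differentiation in the height -/

theorem lineInt_eq_mul (ρ : ℝ → ℂ) (k : ℤ) {u : ℝ} (hu : 0 < u) :
    lineInt ρ k u = ∫ t : ℝ, u * ρ (u ^ 2 * (1 + t ^ 2)) * twist k 1 t := by
  have h := Measure.integral_comp_mul_left (fun v ↦ ρ (v ^ 2 + u ^ 2) * twist k u v) u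
  rw [abs_of_pos (inv_pos.mpr hu)] at h
  have hu' : (u : ℂ) ≠ 0 := by exact_mod_cast hu.ne'
  have h2 : lineInt ρ k u = u * ∫ t : ℝ, ρ ((u * t) ^ 2 + u ^ 2) * twist k u (u * t) := by
    rw [h, Complex.real_smul, lineInt]
    push_cast
    field_simp
  rw [h2, ← integral_const_mul]
  refine integral_congr_ae (Filter.Eventually.of_forall fun t ↦ ?_)
  have h3 := twist_mul k hu 1 t
  rw [mul_one] at h3
  simp only
  rw [h3, show (u * t) ^ 2 + u ^ 2 = u ^ 2 * (1 + t ^ 2) by ring]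
  ring

theorem hasDerivAt_lineInt (h : IsBump ρ α β) {k : ℤ} (hk : Even k) {u : ℝ} (hu : 0 < u) :
    HasDerivAt (lineInt ρ k) (lineInt (euler ρ) k u / u) u := by
  obtain ⟨M, hM0, hM⟩ := h.euler.exists_bound
  have ht := continuous_twist hk one_pos
  have hc := h.continuous
  have hc' := h.euler.continuous
  have hu' : (u : ℂ) ≠ 0 := by exact_mod_cast hu.ne'
  -- near `u` the integrands are supported in `|t| ≤ T`
  set T : ℝ := √(β / (u / 2) ^ 2) with hT
  have hsupp : ∀ {σ : ℝ → ℂ}, IsBump σ α β → ∀ x ∈ Metric.ball u (u / 2), ∀ t : ℝ,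
      t ∉ Icc (-T) T → σ (x ^ 2 * (1 + t ^ 2)) = 0 := by
    intro σ hσ x hx t ht
    refine hσ.eq_zero _ fun hmem ↦ ht (abs_le.mp ?_)
    rw [Metric.mem_ball, Real.dist_eq, abs_lt] at hx
    refine Real.abs_le_sqrt ?_
    rw [le_div_iff₀ (by positivity)]
    have h1 : (u / 2) ^ 2 ≤ x ^ 2 := by
      have : u / 2 ≤ x := by linarith
      gcongr
    calc t ^ 2 * (u / 2) ^ 2 ≤ t ^ 2 * x ^ 2 := by gcongr
      _ ≤ x ^ 2 * (1 + t ^ 2) := by nlinarith [sq_nonneg x]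
      _ ≤ β := hmem.2
  have hpos : ∀ x ∈ Metric.ball u (u / 2), 0 < x := by
    intro x hx
    rw [Metric.mem_ball, Real.dist_eq, abs_lt] at hx
    linarith
  have key := hasDerivAt_integral_of_dominated_loc_of_deriv_le (μ := volume)
    (F := fun (x t : ℝ) ↦ x * ρ (x ^ 2 * (1 + t ^ 2)) * twist k 1 t)
    (F' := fun (x t : ℝ) ↦ euler ρ (x ^ 2 * (1 + t ^ 2)) * twist k 1 t)
    (bound := (Icc (-T) T).indicator fun _ ↦ M) (x₀ := u) (s := Metric.ball u (u / 2))
    (Metric.ball_mem_nhds u (by positivity)) ?_ ?_ ?_ ?_ ?_ ?_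
  · have h2 := key.2
    have e1 : lineInt (euler ρ) k u / u =
        ∫ t : ℝ, euler ρ (u ^ 2 * (1 + t ^ 2)) * twist k 1 t := by
      rw [lineInt_eq_mul _ _ hu, div_eq_iff hu', mul_comm, ← integral_const_mul]
      exact integral_congr_ae (Filter.Eventually.of_forall fun t ↦ by simp only; ring)
    rw [e1]
    refine h2.congr_of_eventuallyEq ?_
    filter_upwards [Metric.ball_mem_nhds u (by positivity : 0 < u / 2)] with x hx
    exact lineInt_eq_mul _ _ (hpos x hx)
  · refine Filter.Eventually.of_forall fun x ↦ Continuous.aestronglyMeasurable (by fun_prop)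
  · refine Continuous.integrable_of_hasCompactSupport (by fun_prop) ?_
    refine HasCompactSupport.intro (isCompact_Icc (a := -T) (b := T)) fun t htT ↦ ?_
    simp [hsupp h u (Metric.mem_ball_self (by positivity)) t htT]
  · exact Continuous.aestronglyMeasurable (by fun_prop)
  · refine Filter.Eventually.of_forall fun t x hx ↦ ?_
    by_cases htT : t ∈ Icc (-T) T
    · rw [indicator_of_mem htT, norm_mul, norm_twist k one_pos, mul_one]
      exact hM _
    · simp [htT, hsupp h.euler x hx t htT]
  · exact (integrable_indicator_iff measurableSet_Icc).mpr (by simp)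
  · refine Filter.Eventually.of_forall fun t x _ ↦ ?_
    have h1 : HasDerivAt (fun x : ℝ ↦ x ^ 2 * (1 + t ^ 2)) (2 * x * (1 + t ^ 2)) x := by
      simpa using (hasDerivAt_pow 2 x).mul_const (1 + t ^ 2)
    have h2 := (h.hasDerivAt (x ^ 2 * (1 + t ^ 2))).scomp x h1
    refine (((Complex.ofRealCLM.hasDerivAt (x := x)).mul h2).mul_const (twist k 1 t)).congr_deriv ?_
    simp only [euler, Complex.real_smul, Complex.ofRealCLM_apply, Function.comp_apply]
    push_cast
    ring

/-! ### The integral over all heights -/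

theorem integral_euler (h : IsBump ρ α β) : ∫ x, euler ρ x = -∫ x, ρ x := by
  have hd : ∀ x : ℝ, HasDerivAt (fun x : ℝ ↦ 2 * ((x : ℂ) * ρ x)) (euler ρ x + ρ x) x := by
    intro x
    refine (((Complex.ofRealCLM.hasDerivAt (x := x)).mul (h.hasDerivAt x)).const_mul 2).congr_deriv ?_
    simp [euler]
    ring
  have hq : IsBump (fun x ↦ (x : ℂ) * ρ x) α β := h.mul_left contDiffOn_ofReal
  have := integral_eq_zero_of_hasDerivAt_of_integrable hd (h.euler.integrable.add h.integrable)
    (hq.integrable.const_mul 2)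
  rw [integral_add h.euler.integrable h.integrable] at this
  exact eq_neg_of_add_eq_zero_left this

theorem integral_euler_eulerTail (h : IsBump ρ α β) :
    ∫ x, euler (eulerTail ρ) x = 2 * ∫ x, ρ x := by
  have h1 : ∫ x, euler ρ x = (∫ x, ρ x) + ∫ x, eulerTail ρ x :=
    integral_add h.integrable h.eulerTail.integrable
  rw [integral_euler h.eulerTail]
  rw [integral_euler h] at h1
  linear_combination h1

theorem integral_twist_div {k : ℤ} (hk : Even k) :
    ∫ t : ℝ, twist k 1 t * ((1 + t ^ 2)⁻¹ : ℝ) = if k = 0 then (Real.pi : ℂ) else 0 := by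
  split_ifs with h0
  · subst h0
    simp only [twist_zero, one_mul]
    rw [integral_complex_ofReal, integral_univ_inv_one_add_sq]
  · have hk0 : (k : ℂ) ≠ 0 := by exact_mod_cast h0
    have hint : Integrable fun t : ℝ ↦ twist k 1 t * ((1 + t ^ 2)⁻¹ : ℝ) := by
      refine (integrable_inv_one_add_sq.ofReal (𝕜 := ℂ)).bdd_mul (c := 1)
        (continuous_twist hk one_pos).aestronglyMeasurable
        (Filter.Eventually.of_forall fun t ↦ (norm_twist k one_pos t).le)
    have hd : ∀ t : ℝ, HasDerivAt (fun t ↦ twist k 1 t / (Complex.I * k))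
        (twist k 1 t * ((1 + t ^ 2)⁻¹ : ℝ)) t := by
      intro t
      refine ((hasDerivAt_twist hk one_pos t).div_const (Complex.I * k)).congr_deriv ?_
      have : (1 + (t : ℂ) ^ 2) ≠ 0 := by exact_mod_cast (by positivity : 1 + t ^ 2 ≠ 0)
      have h2 : ((t : ℂ) ^ 2 + 1) ≠ 0 := by rwa [add_comm]
      push_cast
      field_simp
      ring
    have hratio : ∀ l : Filter ℝ, Filter.Tendsto (fun t : ℝ ↦ t⁻¹) l (nhds 0) →
        (∀ᶠ t in l, t ≠ 0) →
        Filter.Tendsto (fun t ↦ twist k 1 t / (Complex.I * k)) l (nhds (1 / (Complex.I * k))) := by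
      intro l hl hl0
      obtain ⟨m, rfl⟩ := hk
      refine Filter.Tendsto.div_const ?_ _
      -- `(t + i) / (t - i) = (1 + i / t) / (1 - i / t)` tends to `1`
      have h1 : Filter.Tendsto (fun t : ℝ ↦
          ((1 + ((t⁻¹ : ℝ) : ℂ) * Complex.I) / (1 - ((t⁻¹ : ℝ) : ℂ) * Complex.I)) ^ (-m)) l
          (nhds (((1 + ((0 : ℝ) : ℂ) * Complex.I) / (1 - ((0 : ℝ) : ℂ) * Complex.I)) ^ (-m))) := by
        have h2 : Filter.Tendsto (fun t : ℝ ↦ ((t⁻¹ : ℝ) : ℂ) * Complex.I) l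
            (nhds (((0 : ℝ) : ℂ) * Complex.I)) :=
          ((Complex.continuous_ofReal.tendsto 0).comp hl).mul_const _
        refine Filter.Tendsto.zpow₀ ?_ _ (Or.inl (by simp))
        exact (h2.const_add 1).div (h2.const_sub 1) (by simp)
      simp only [Complex.ofReal_zero, zero_mul, add_zero, sub_zero, div_one, one_zpow] at h1
      refine h1.congr' ?_
      filter_upwards [hl0] with t ht
      rw [twist_eq_div one_pos]
      congr 1
      have ht' : (t : ℂ) ≠ 0 := by exact_mod_cast ht
      push_cast
      rw [show (t : ℂ) + 1 * Complex.I = t * (1 + (t : ℂ)⁻¹ * Complex.I) by field_simp,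
        show (t : ℂ) - 1 * Complex.I = t * (1 - (t : ℂ)⁻¹ * Complex.I) by field_simp,
        mul_div_mul_left _ _ ht']
    rw [integral_of_hasDerivAt_of_tendsto hd hint
      (hratio _ tendsto_inv_atBot_zero (Filter.eventually_ne_atBot 0))
      (hratio _ tendsto_inv_atTop_zero (Filter.eventually_ne_atTop 0)), sub_self]

theorem integral_Ioi_mul_comp_sq {F : Type*} [NormedAddCommGroup F] [NormedSpace ℝ F] (f : ℝ → F)
    (t : ℝ) : ∫ u in Ioi (0 : ℝ), u • f (u ^ 2 * (1 + t ^ 2)) =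
      ((1 + t ^ 2)⁻¹ / 2) • ∫ x in Ioi (0 : ℝ), f x := by
  have h0 : (0 : ℝ) < 1 + t ^ 2 := by positivity
  have h1 := integral_comp_rpow_Ioi_of_pos (g := fun x ↦ f (x * (1 + t ^ 2))) (p := 2) two_pos
  have h2 := integral_comp_mul_right_Ioi f 0 h0
  rw [zero_mul] at h2
  rw [h2] at h1
  rw [div_eq_inv_mul, mul_smul, ← h1, ← integral_smul]
  refine setIntegral_congr_fun measurableSet_Ioi fun u hu ↦ ?_
  simp only [smul_smul]
  norm_num
  congr 1
  ring

/-- Fubini in polar-type coordinates `v = u t`: the angular part decouples. -/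
theorem integral_lineInt (h : IsBump ρ α β) {k : ℤ} (hk : Even k) :
    IntegrableOn (lineInt ρ k) (Ioi 0) ∧
      ∫ u in Ioi (0 : ℝ), lineInt ρ k u = (if k = 0 then (Real.pi : ℂ) else 0) / 2 * ∫ x, ρ x := by
  have ht := continuous_twist hk one_pos
  have hc := h.continuous
  have hF : Continuous fun p : ℝ × ℝ ↦
      (p.1 : ℂ) * ρ (p.1 ^ 2 * (1 + p.2 ^ 2)) * twist k 1 p.2 := by fun_prop
  have hint : Integrable (fun p : ℝ × ℝ ↦
      (p.1 : ℂ) * ρ (p.1 ^ 2 * (1 + p.2 ^ 2)) * twist k 1 p.2)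
      ((volume.restrict (Ioi 0)).prod volume) := by
    rw [integrable_prod_iff' hF.aestronglyMeasurable]
    constructor
    · refine Filter.Eventually.of_forall fun t ↦ ?_
      refine Integrable.restrict ?_
      refine Continuous.integrable_of_hasCompactSupport (by fun_prop) ?_
      refine HasCompactSupport.intro (isCompact_Icc (a := -√β) (b := √β)) fun u hu ↦ ?_
      have : ρ (u ^ 2 * (1 + t ^ 2)) = 0 := by
        refine h.eq_zero _ fun hmem ↦ hu (abs_le.mp (Real.abs_le_sqrt ?_))
        nlinarith [hmem.2, mul_nonneg (sq_nonneg u) (sq_nonneg t)]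
      simp [this]
    · have e1 : ∀ t : ℝ, ∫ u in Ioi (0 : ℝ), ‖(u : ℂ) * ρ (u ^ 2 * (1 + t ^ 2)) * twist k 1 t‖ =
          (1 + t ^ 2)⁻¹ * ((∫ x in Ioi (0 : ℝ), ‖ρ x‖) / 2) := by
        intro t
        have := integral_Ioi_mul_comp_sq (fun x ↦ ‖ρ x‖) t
        simp only [smul_eq_mul] at this
        rw [mul_div_assoc', mul_div_right_comm, ← this]
        refine setIntegral_congr_fun measurableSet_Ioi fun u hu ↦ ?_
        rw [norm_mul, norm_mul, norm_twist k one_pos, mul_one, Complex.norm_real,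
          Real.norm_of_nonneg (le_of_lt hu)]
      simp only [e1]
      exact integrable_inv_one_add_sq.mul_const _
  have hcongr : EqOn (lineInt ρ k)
      (fun u ↦ ∫ t : ℝ, u * ρ (u ^ 2 * (1 + t ^ 2)) * twist k 1 t) (Ioi 0) :=
    fun u hu ↦ lineInt_eq_mul ρ k hu
  refine ⟨IntegrableOn.congr_fun hint.integral_prod_left hcongr.symm measurableSet_Ioi, ?_⟩
  rw [setIntegral_congr_fun measurableSet_Ioi hcongr, integral_integral_swap hint]
  have e2 : ∀ t : ℝ, ∫ u in Ioi (0 : ℝ), (u : ℂ) * ρ (u ^ 2 * (1 + t ^ 2)) * twist k 1 t =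
      (∫ x, ρ x) / 2 * (twist k 1 t * ((1 + t ^ 2)⁻¹ : ℝ)) := by
    intro t
    rw [integral_mul_const]
    have := integral_Ioi_mul_comp_sq ρ t
    simp only [Complex.real_smul] at this
    rw [this, h.integral_Ioi]
    push_cast
    ring
  simp only [e2]
  rw [integral_const_mul, integral_twist_div hk]
  ring

end

section

open MeasureTheory Set
open scoped ContDiff

variable {ρ σ : ℝ → ℂ} {α β : ℝ}

/-! ### The sum over the moduli at frequency zero -/

theorem euler_euler (h : IsBump ρ α β) :
    euler (euler ρ) = fun x ↦ euler ρ x + euler (eulerTail ρ) x := by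
  ext x
  have h1 : HasDerivAt (euler ρ) (deriv ρ x + deriv (eulerTail ρ) x) x :=
    (h.hasDerivAt x).add (h.eulerTail.hasDerivAt x)
  rw [euler, h1.deriv, euler, euler, eulerTail]
  ring

theorem hasDerivAt_lineInt_mul (h : IsBump ρ α β) {k : ℤ} (hk : Even k) {ε : ℝ} (hε : 0 < ε)
    {x : ℝ} (hx : 0 < x) :
    HasDerivAt (fun x ↦ lineInt ρ k (ε * x)) (lineInt (euler ρ) k (ε * x) / x) x := by
  have h1 : HasDerivAt (fun x : ℝ ↦ ε * x) ε x := by simpa using (hasDerivAt_id x).const_mul ε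
  refine ((hasDerivAt_lineInt h hk (mul_pos hε hx)).scomp x h1).congr_deriv ?_
  have hε' : (ε : ℂ) ≠ 0 := by exact_mod_cast hε.ne'
  have hx' : (x : ℂ) ≠ 0 := by exact_mod_cast hx.ne'
  rw [Complex.real_smul]
  push_cast
  field_simp

theorem hasDerivAt_lineInt_euler_div (h : IsBump ρ α β) {k : ℤ} (hk : Even k) {ε : ℝ} (hε : 0 < ε)
    {x : ℝ} (hx : 0 < x) : HasDerivAt (fun x : ℝ ↦ lineInt (euler ρ) k (ε * x) / x)
      (lineInt (euler (eulerTail ρ)) k (ε * x) / x ^ 2) x := by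
  have hx' : (x : ℂ) ≠ 0 := by exact_mod_cast hx.ne'
  refine ((hasDerivAt_lineInt_mul h.euler hk hε hx).div
    (Complex.ofRealCLM.hasDerivAt (x := x)) hx').congr_deriv ?_
  rw [euler_euler h, lineInt_add h.euler h.eulerTail.euler hk (mul_pos hε hx)]
  simp only [Complex.ofRealCLM_apply]
  push_cast
  field_simp
  ring

theorem continuousOn_lineInt_mul (h : IsBump ρ α β) {k : ℤ} (hk : Even k) {ε : ℝ} (hε : 0 < ε) :
    ContinuousOn (fun x ↦ lineInt ρ k (ε * x)) (Ioi 0) := fun _ hx ↦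
  (hasDerivAt_lineInt_mul h hk hε hx).continuousAt.continuousWithinAt

/-- Taylor's formula from the right end of the support, with second order remainder. -/
theorem lineInt_mul_eq_integral (h : IsBump ρ α β) {k : ℤ} (hk : Even k) {ε : ℝ} (hε : 0 < ε)
    {c N : ℝ} (hc : 1 ≤ c) (hcN : c ≤ N) (hN : √β < ε * N) :
    lineInt ρ k (ε * c) =
      ∫ x in (1 : ℝ)..N, ((max (x - c) 0 : ℝ) : ℂ) * (lineInt (euler (eulerTail ρ)) k (ε * x) / x ^ 2) := by
  have hcont : ContinuousOn (fun x : ℝ ↦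
      ((max (x - c) 0 : ℝ) : ℂ) * (lineInt (euler (eulerTail ρ)) k (ε * x) / x ^ 2)) (Ioi 0) := by
    have hm : Continuous fun x : ℝ ↦ ((max (x - c) 0 : ℝ) : ℂ) := by fun_prop
    refine hm.continuousOn.mul ((continuousOn_lineInt_mul h.eulerTail.euler hk hε).div
      (by fun_prop) fun x hx ↦ ?_)
    have : (x : ℂ) ≠ 0 := by exact_mod_cast (ne_of_gt hx)
    exact pow_ne_zero 2 this
  have hii : ∀ {a b : ℝ}, 1 ≤ a → a ≤ b → IntervalIntegrable (fun x : ℝ ↦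
      ((max (x - c) 0 : ℝ) : ℂ) * (lineInt (euler (eulerTail ρ)) k (ε * x) / x ^ 2)) volume a b := by
    intro a b ha hab
    refine (hcont.mono fun x hx ↦ ?_).intervalIntegrable
    rw [uIcc_of_le hab] at hx
    exact lt_of_lt_of_le (by linarith) hx.1
  rw [← intervalIntegral.integral_add_adjacent_intervals (hii le_rfl hc) (hii hc hcN)]
  have e1 : ∫ x in (1 : ℝ)..c, ((max (x - c) 0 : ℝ) : ℂ) *
      (lineInt (euler (eulerTail ρ)) k (ε * x) / x ^ 2) = 0 := by
    rw [intervalIntegral.integral_congr (g := fun _ ↦ (0 : ℂ)) fun x hx ↦ ?_]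
    · simp
    · rw [uIcc_of_le hc] at hx
      simp [max_eq_right (sub_nonpos.mpr hx.2)]
  have hder : ∀ x ∈ uIcc c N, HasDerivAt
      (fun x : ℝ ↦ ((x : ℂ) - c) * (lineInt (euler ρ) k (ε * x) / x) - lineInt ρ k (ε * x))
      (((max (x - c) 0 : ℝ) : ℂ) * (lineInt (euler (eulerTail ρ)) k (ε * x) / x ^ 2)) x := by
    intro x hx
    rw [uIcc_of_le hcN] at hx
    have hx0 : 0 < x := by linarith [hx.1]
    have h1 : HasDerivAt (fun x : ℝ ↦ (x : ℂ) - c) 1 x :=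
      (Complex.ofRealCLM.hasDerivAt (x := x)).sub_const _
    refine ((h1.mul (hasDerivAt_lineInt_euler_div h hk hε hx0)).sub
      (hasDerivAt_lineInt_mul h hk hε hx0)).congr_deriv ?_
    rw [max_eq_left (sub_nonneg.mpr hx.1)]
    push_cast
    ring
  rw [e1, zero_add, intervalIntegral.integral_eq_sub_of_hasDerivAt hder (hii hc hcN),
    lineInt_eq_zero h.euler k hN, lineInt_eq_zero h k hN]
  simp

theorem sum_totient_max_eq {N : ℕ} {x : ℝ} (hx : 0 ≤ x) (hxN : x ≤ N) :
    ∑ c ∈ Finset.Ioc 0 N, (Nat.totient c : ℝ) / c * max (x - c) 0 =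
      ∑ c ∈ Finset.Ioc 0 ⌊x⌋₊, (Nat.totient c : ℝ) / c * (x - c) := by
  have hsub : Finset.Ioc 0 ⌊x⌋₊ ⊆ Finset.Ioc 0 N :=
    Finset.Ioc_subset_Ioc_right (Nat.floor_le_of_le hxN)
  rw [← Finset.sum_subset hsub]
  · refine Finset.sum_congr rfl fun c hc ↦ ?_
    rw [Finset.mem_Ioc, Nat.le_floor_iff hx] at hc
    rw [max_eq_left (sub_nonneg.mpr hc.2)]
  · intro c hc hc'
    rw [Finset.mem_Ioc] at hc hc'
    rw [Nat.le_floor_iff hx] at hc'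
    have : x ≤ c := by
      by_contra hcon
      exact hc' ⟨hc.1, (not_le.mp hcon).le⟩
    rw [max_eq_right (sub_nonpos.mpr this), mul_zero]

theorem integral_div_one_add_mul_sq_le {l N : ℝ} (hl : 0 < l) :
    ∫ x in (1 : ℝ)..N, l / (1 + (l * x) ^ 2) ≤ Real.pi := by
  have h := intervalIntegral.integral_comp_mul_left (a := 1) (b := N)
    (fun x : ℝ ↦ (1 + x ^ 2)⁻¹) hl.ne'
  simp only [div_eq_mul_inv]
  rw [intervalIntegral.integral_const_mul, h, integral_inv_one_add_sq, smul_eq_mul,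
    mul_inv_cancel_left₀ hl.ne']
  linarith [Real.arctan_lt_pi_div_two (l * N), Real.neg_pi_div_two_lt_arctan (l * 1)]

/-- The sum over the moduli at frequency zero, with an error term uniform in `k` and in the step `ε`. -/
theorem exists_norm_sum_totient_lineInt_sub_le (h : IsBump ρ α β) :
    ∃ C : ℝ, 0 ≤ C ∧ ∀ k : ℤ, Even k → ∀ ε : ℝ, 0 < ε → ∀ N : ℕ, 1 ≤ N → √β < ε * N →
      ‖∑ c ∈ Finset.Ioc 0 N, (Nat.totient c : ℂ) / c * lineInt ρ k (ε * c) -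
        (ε : ℂ)⁻¹ * ((if k = 0 then 3 / (Real.pi : ℂ) else 0) * ∫ x, ρ x)‖ ≤ C := by
  have hb := h.eulerTail.euler
  obtain ⟨C1, hC1, H1⟩ := exists_norm_lineInt_euler_le_div h.eulerTail
  obtain ⟨C2, hC2, H2⟩ := exists_norm_lineInt_le hb
  refine ⟨3 * C1 * Real.pi + 3 / Real.pi ^ 2 * C2, by positivity, fun k hk ε hε N hN hεN ↦ ?_⟩
  set γ : ℝ → ℂ := fun x ↦ lineInt (euler (eulerTail ρ)) k (ε * x) with hγ
  have hN' : (1 : ℝ) ≤ N := by exact_mod_cast hN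
  have hγc : ContinuousOn γ (Ioi 0) := continuousOn_lineInt_mul hb hk hε
  have hsub : uIcc (1 : ℝ) N ⊆ Ioi 0 := by
    intro x hx
    rw [uIcc_of_le hN'] at hx
    exact lt_of_lt_of_le one_pos hx.1
  have hx0 : ∀ x ∈ uIcc (1 : ℝ) N, (x : ℂ) ^ 2 ≠ 0 := by
    intro x hx
    have : (x : ℂ) ≠ 0 := by exact_mod_cast (ne_of_gt (hsub hx))
    exact pow_ne_zero 2 this
  have hγd : ContinuousOn (fun x : ℝ ↦ γ x / (x : ℂ) ^ 2) (uIcc 1 N) :=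
    (hγc.mono hsub).div (by fun_prop) hx0
  set S : ℝ → ℝ := fun x ↦ ∑ c ∈ Finset.Ioc 0 N, (Nat.totient c : ℝ) / c * max (x - c) 0 with hS
  have hSc : Continuous S := by
    refine continuous_finsetSum _ fun c _ ↦ ?_
    fun_prop
  -- the sum is the integral of the Riesz mean against `γ(x) / x²`
  have e1 : ∑ c ∈ Finset.Ioc 0 N, (Nat.totient c : ℂ) / c * lineInt ρ k (ε * c) =
      ∫ x in (1 : ℝ)..N, (S x : ℂ) * (γ x / (x : ℂ) ^ 2) := by
    have e2 : ∀ c ∈ Finset.Ioc 0 N, (Nat.totient c : ℂ) / c * lineInt ρ k (ε * c) =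
        ∫ x in (1 : ℝ)..N, (Nat.totient c : ℂ) / c * (((max (x - c) 0 : ℝ) : ℂ) *
          (γ x / (x : ℂ) ^ 2)) := by
      intro c hc
      rw [Finset.mem_Ioc] at hc
      rw [intervalIntegral.integral_const_mul, lineInt_mul_eq_integral h hk hε
        (by exact_mod_cast hc.1) (by exact_mod_cast hc.2) hεN]
    rw [Finset.sum_congr rfl e2, ← intervalIntegral.integral_finsetSum]
    · refine intervalIntegral.integral_congr fun x _ ↦ ?_
      simp only [hS]
      push_cast
      rw [Finset.sum_mul]
      exact Finset.sum_congr rfl fun c _ ↦ by ring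
    · intro c _
      refine ContinuousOn.intervalIntegrable ?_
      have hm : Continuous fun x : ℝ ↦ ((max (x - c) 0 : ℝ) : ℂ) := by fun_prop
      exact continuousOn_const.mul (hm.continuousOn.mul hγd)
  have hγi : IntervalIntegrable γ volume 1 N := (hγc.mono hsub).intervalIntegrable
  have i1 : IntervalIntegrable (fun x ↦ (S x : ℂ) * (γ x / (x : ℂ) ^ 2)) volume 1 N := by
    have hm : Continuous fun x : ℝ ↦ (S x : ℂ) := by fun_prop
    exact (hm.continuousOn.mul hγd).intervalIntegrable
  have e3 : (∫ x in (1 : ℝ)..N, (S x : ℂ) * (γ x / (x : ℂ) ^ 2)) -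
      (3 / (Real.pi : ℂ) ^ 2) * ∫ x in (1 : ℝ)..N, γ x =
      ∫ x in (1 : ℝ)..N, ((S x - 3 / Real.pi ^ 2 * x ^ 2 : ℝ) : ℂ) * (γ x / (x : ℂ) ^ 2) := by
    rw [← intervalIntegral.integral_const_mul,
      ← intervalIntegral.integral_sub i1 (hγi.const_mul _)]
    refine intervalIntegral.integral_congr fun x hx ↦ ?_
    have : (x : ℂ) ≠ 0 := by exact_mod_cast (ne_of_gt (hsub hx))
    push_cast
    field_simp
  have b1 : ‖∫ x in (1 : ℝ)..N, ((S x - 3 / Real.pi ^ 2 * x ^ 2 : ℝ) : ℂ) *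
      (γ x / (x : ℂ) ^ 2)‖ ≤ 3 * C1 * Real.pi := by
    set l := max 1 (k.natAbs : ℝ) * ε with hl
    have hl0 : 0 < l := by positivity
    have hlc : Continuous fun x : ℝ ↦ l / (1 + (l * x) ^ 2) :=
      Continuous.div (by fun_prop) (by fun_prop) fun x ↦ by positivity
    refine (intervalIntegral.norm_integral_le_of_norm_le (g := fun x ↦
      3 * C1 * (l / (1 + (l * x) ^ 2))) hN' (Filter.Eventually.of_forall fun x hx ↦ ?_)
      (Continuous.intervalIntegrable (by fun_prop) _ _)).trans ?_
    · have hx1 : 0 < x := one_pos.trans hx.1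
      rw [norm_mul, norm_div, Complex.norm_real, norm_pow, Complex.norm_real,
        Real.norm_of_nonneg hx1.le, Real.norm_eq_abs]
      have hR : |S x - 3 / Real.pi ^ 2 * x ^ 2| ≤ 3 * x := by
        rw [hS]
        simp only
        rw [sum_totient_max_eq hx1.le hx.2]
        exact riesz_mean_totient_bound hx1.le
      have hg := H1 k hk (ε * x) (mul_pos hε hx1)
      rw [← mul_assoc (max 1 (k.natAbs : ℝ)), ← hl] at hg
      calc _ ≤ 3 * x * (C1 * (l * x / (1 + (l * x) ^ 2)) / x ^ 2) := by gcongr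
        _ = 3 * C1 * (l / (1 + (l * x) ^ 2)) := by field_simp
    · rw [intervalIntegral.integral_const_mul]
      gcongr
      exact integral_div_one_add_mul_sq_le hl0
  have e4 : ∫ x in (1 : ℝ)..N, γ x = (ε : ℂ)⁻¹ * ((if k = 0 then (Real.pi : ℂ) else 0) *
      ∫ x, ρ x) - ∫ x in Ioc (0 : ℝ) 1, γ x := by
    obtain ⟨hI, hI2⟩ := integral_lineInt hb hk
    have hγI : IntegrableOn γ (Ioi 0) := by
      have := (integrableOn_Ioi_comp_mul_left_iff
        (lineInt (euler (eulerTail ρ)) k) 0 hε).mpr (by simpa using hI)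
      exact this
    have h1 := integral_comp_mul_left_Ioi (lineInt (euler (eulerTail ρ)) k) 0 hε
    rw [mul_zero, hI2, integral_euler_eulerTail h] at h1
    have h2 : ∫ x in Ioi (0 : ℝ), γ x = ∫ x in Ioc (0 : ℝ) N, γ x := by
      refine setIntegral_eq_of_subset_of_forall_sdiff_eq_zero measurableSet_Ioi
        Ioc_subset_Ioi_self fun x hx ↦ ?_
      refine lineInt_eq_zero hb k (hεN.trans ?_)
      have : (N : ℝ) < x := by
        by_contra hc
        exact hx.2 ⟨hx.1, not_lt.mp hc⟩
      gcongr
    have h3 : ∫ x in Ioc (0 : ℝ) N, γ x =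
        (∫ x in Ioc (0 : ℝ) 1, γ x) + ∫ x in Ioc (1 : ℝ) N, γ x := by
      rw [← Ioc_union_Ioc_eq_Ioc zero_le_one hN', setIntegral_union
        (Ioc_disjoint_Ioc_of_le le_rfl) measurableSet_Ioc
        (hγI.mono_set Ioc_subset_Ioi_self) (hγI.mono_set fun x hx ↦ one_pos.trans hx.1)]
    rw [intervalIntegral.integral_of_le hN', eq_sub_iff_add_eq, add_comm, ← h3, ← h2, h1,
      Complex.real_smul]
    push_cast
    ring
  have b2 : ‖∫ x in Ioc (0 : ℝ) 1, γ x‖ ≤ C2 := by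
    refine (norm_setIntegral_le_of_norm_le_const (C := C2) (by simp)
      fun x hx ↦ H2 k _ (mul_pos hε hx.1)).trans ?_
    simp
  have e5 : (if k = 0 then 3 / (Real.pi : ℂ) else 0) =
      3 / (Real.pi : ℂ) ^ 2 * (if k = 0 then (Real.pi : ℂ) else 0) := by
    have : (Real.pi : ℂ) ≠ 0 := by exact_mod_cast Real.pi_ne_zero
    split_ifs
    · field_simp
    · simp
  have e6 : (∫ x in (1 : ℝ)..N, (S x : ℂ) * (γ x / (x : ℂ) ^ 2)) -
      (ε : ℂ)⁻¹ * ((if k = 0 then 3 / (Real.pi : ℂ) else 0) * ∫ x, ρ x) =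
      (∫ x in (1 : ℝ)..N, ((S x - 3 / Real.pi ^ 2 * x ^ 2 : ℝ) : ℂ) * (γ x / (x : ℂ) ^ 2)) -
        (3 / (Real.pi : ℂ) ^ 2) * ∫ x in Ioc (0 : ℝ) 1, γ x := by
    rw [← e3, e4, e5]
    ring
  rw [e1, e6]
  refine (norm_sub_le _ _).trans (add_le_add b1 ?_)
  rw [norm_mul]
  refine mul_le_mul (le_of_eq ?_) b2 (norm_nonneg _) (by positivity)
  rw [norm_div, norm_pow, Complex.norm_real, Complex.norm_ofNat, Real.norm_of_nonneg Real.pi_pos.le]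

end

section

open MeasureTheory Set
open scoped ContDiff

/-! ### Cosets and bottom rows -/

/-- The normalised bottom rows: coprime pairs `(c, d)` with `c > 0`, together with `(0, 1)`. -/
def normalizedRows : Set (ℤ × ℤ) := {p | IsCoprime p.1 p.2 ∧ (0 < p.1 ∨ p = (0, 1))}

/-- The summand of the incomplete Eisenstein series attached to the bottom row `(c, d)`. -/
noncomputable def rowSummand (k : ℤ) (ψ : ℝ → ℂ) (z : UpperHalfPlane) (p : ℤ × ℤ) : ℂ :=
  ψ (z.im / Complex.normSq (p.1 * z + p.2)) *
    ((p.1 * (z : ℂ) + p.2) / (‖(p.1 * (z : ℂ) + p.2)‖ : ℂ)) ^ (-k)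

/-- Two matrices lie in the same coset of `gammaInf` exactly when their bottom rows are proportional. -/
theorem rightRel_iff (γ γ' : SL(2, ℤ)) : QuotientGroup.rightRel gammaInf γ γ' ↔
    γ' 1 0 * γ 1 1 = γ' 1 1 * γ 1 0 := by
  rw [QuotientGroup.rightRel_apply]
  change (γ' * γ⁻¹) 1 0 = 0 ↔ _
  simp only [Matrix.SpecialLinearGroup.coe_mul, Matrix.SpecialLinearGroup.coe_inv,
    Matrix.adjugate_fin_two, Matrix.mul_apply, Fin.sum_univ_two, Matrix.of_apply,
    Matrix.cons_val', Matrix.cons_val_zero, Matrix.cons_val_one, Matrix.cons_val_fin_one]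
  constructor <;> intro h <;> linarith

theorem exists_row (p : normalizedRows) : ∃ γ : SL(2, ℤ), γ 1 0 = p.1.1 ∧ γ 1 1 = p.1.2 := by
  obtain ⟨γ, -, h⟩ := ModularGroup.bottom_row_surj (R := ℤ)
    (show ![p.1.1, p.1.2] ∈ {cd : Fin 2 → ℤ | IsCoprime (cd 0) (cd 1)} by simpa using p.2.1)
  exact ⟨γ, by simpa using congrFun h 0, by simpa using congrFun h 1⟩

/-- The coset of the matrices with a given normalised bottom row. -/
noncomputable def rowCoset (p : normalizedRows) : Cosets := Quotient.mk _ (exists_row p).choose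

theorem rowCoset_bijective : Function.Bijective rowCoset := by
  constructor
  · intro p q h
    have h' := (rightRel_iff _ _).mp (Quotient.exact h)
    rw [(exists_row p).choose_spec.1, (exists_row p).choose_spec.2, (exists_row q).choose_spec.1,
      (exists_row q).choose_spec.2] at h'
    obtain ⟨⟨c, d⟩, hp, hp'⟩ := p
    obtain ⟨⟨c', d'⟩, hq, hq'⟩ := q
    simp only [Prod.mk.injEq] at h' hp hp' hq hq'
    refine Subtype.ext (Prod.ext_iff.mpr ?_)
    change c = c' ∧ d = d'
    have h1 : c' ∣ c := hq.dvd_of_dvd_mul_left ⟨d, h'.symm⟩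
    have h2 : c ∣ c' := hp.dvd_of_dvd_mul_right ⟨d', by rw [h']; ring⟩
    have hc : 0 ≤ c := by rcases hp' with h | h <;> lia
    have hc' : 0 ≤ c' := by rcases hq' with h | h <;> lia
    have hcc : c = c' := Int.dvd_antisymm hc hc' h2 h1
    subst hcc
    refine ⟨rfl, ?_⟩
    rcases hp' with hp' | hp'
    · have : c * d = c * d' := by rw [h']; ring
      exact mul_left_cancel₀ hp'.ne' this
    · rcases hq' with hq' | hq'
      · lia
      · rw [hp'.2, hq'.2]
  · intro Q
    induction Q using Quotient.inductionOn with
    | h γ =>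
      have hcop := ModularGroup.bottom_row_coprime γ
      have key : ∀ p : normalizedRows, γ 1 0 * p.1.2 = γ 1 1 * p.1.1 →
          rowCoset p = Quotient.mk _ γ := by
        intro p hp
        refine Quotient.sound ((rightRel_iff _ _).mpr ?_)
        rw [(exists_row p).choose_spec.1, (exists_row p).choose_spec.2, hp]
      rcases lt_trichotomy (γ 1 0) 0 with h | h | h
      · exact ⟨⟨(-γ 1 0, -γ 1 1), hcop.neg_neg, Or.inl (by simpa using h)⟩, key _ (by simp; ring)⟩
      · exact ⟨⟨(0, 1), isCoprime_zero_left.mpr isUnit_one, Or.inr rfl⟩, key _ (by simp [h])⟩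
      · exact ⟨⟨(γ 1 0, γ 1 1), hcop, Or.inl h⟩, key _ (by simp; ring)⟩

theorem cosetSummand_rowCoset {k : ℤ} (hk : Even k) (ψ : ℝ → ℂ) (z : UpperHalfPlane)
    (p : normalizedRows) : cosetSummand k hk ψ z (rowCoset p) = rowSummand k ψ z p := by
  change summand k ψ z (exists_row p).choose = _
  rw [summand, autFactor, im_smul_eq, cocycle, (exists_row p).choose_spec.1,
    (exists_row p).choose_spec.2, rowSummand]

theorem hasSum_cosetSummand_iff {k : ℤ} (hk : Even k) (ψ : ℝ → ℂ) (z : UpperHalfPlane) (s : ℂ) :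
    HasSum (cosetSummand k hk ψ z) s ↔
      HasSum (normalizedRows.indicator (rowSummand k ψ z)) s := by
  rw [← (Equiv.ofBijective _ rowCoset_bijective).hasSum_iff, ← hasSum_subtype_iff_indicator]
  refine iff_of_eq (congrArg (HasSum · s) ?_)
  ext p
  exact cosetSummand_rowCoset hk ψ z p

/-! ### Sums over rows -/

theorem hasSum_int_of_residues {f : ℤ → ℂ} {c : ℕ} (hc : 0 < c) {S : ℕ → ℂ}
    (h : ∀ r ∈ Finset.range c, HasSum (fun q : ℤ ↦ f (r + c * q)) (S r)) :
    HasSum f (∑ r ∈ Finset.range c, S r) := by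
  have hc' : (0 : ℤ) < c := by exact_mod_cast hc
  have h1 : ∀ r ∈ Finset.range c,
      HasSum (fun d : ℤ ↦ if d % c = r then f d else 0) (S r) := by
    intro r hr
    have hr' : (r : ℤ) < c := by exact_mod_cast Finset.mem_range.mp hr
    have hmod : ∀ q : ℤ, (r + c * q) % c = (r : ℤ) := by
      intro q
      rw [Int.add_mul_emod_self_left]
      exact Int.emod_eq_of_lt (by positivity) hr'
    have hinj : Function.Injective fun q : ℤ ↦ (r + c * q : ℤ) := by
      intro q q' hq
      exact mul_left_cancel₀ hc'.ne' (add_left_cancel hq)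
    refine (hinj.hasSum_iff ?_).mp ?_
    · intro d hd
      rw [if_neg]
      intro hdr
      refine hd ⟨d / c, ?_⟩
      simp only
      rw [← hdr]
      exact Int.emod_add_mul_ediv d c
    · refine (h r hr).congr_fun ?_
      intro q
      simp [hmod q]
  have h2 := hasSum_sum h1
  refine h2.congr_fun fun d ↦ ?_
  have hd0 := Int.emod_nonneg d hc'.ne'
  have hdc := Int.emod_lt_of_pos d hc'
  rw [Finset.sum_eq_single_of_mem (d % c).toNat]
  · rw [if_pos (Int.toNat_of_nonneg hd0).symm]
  · rw [Finset.mem_range]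
    lia
  · intro r _ hr
    rw [if_neg]
    intro h
    apply hr
    lia

/-- A function on `ℤ × ℤ` supported on `(0, 1)` and on the rows `0 < c ≤ N` is summed row by row. -/
theorem hasSum_of_rows {F : ℤ × ℤ → ℂ} {N : ℕ} {S : ℕ → ℂ}
    (h0 : ∀ p : ℤ × ℤ, p ≠ (0, 1) → ¬ (0 < p.1 ∧ p.1 ≤ N) → F p = 0)
    (h : ∀ c ∈ Finset.Ioc 0 N, HasSum (fun d : ℤ ↦ F (c, d)) (S c)) :
    HasSum F (F (0, 1) + ∑ c ∈ Finset.Ioc 0 N, S c) := by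
  have h1 : ∀ c ∈ Finset.Ioc 0 N, HasSum (fun p : ℤ × ℤ ↦ if p.1 = c then F p else 0) (S c) := by
    intro c hc
    have hinj : Function.Injective fun d : ℤ ↦ ((c : ℤ), d) := fun d d' hd ↦ (Prod.mk.inj hd).2
    refine (hinj.hasSum_iff ?_).mp ?_
    · intro p hp
      rw [if_neg]
      intro hpc
      exact hp ⟨p.2, by rw [← hpc]⟩
    · refine (h c hc).congr_fun ?_
      intro d
      simp
  have h2 := (hasSum_single (f := fun p : ℤ × ℤ ↦ if p = (0, 1) then F p else 0) (0, 1)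
    (fun p hp ↦ if_neg hp)).add (hasSum_sum h1)
  simp only [if_true] at h2
  refine h2.congr_fun fun p ↦ ?_
  by_cases hp : p = (0, 1)
  · subst hp
    rw [if_pos rfl, Finset.sum_eq_zero, add_zero]
    intro c hc
    rw [Finset.mem_Ioc] at hc
    rw [if_neg]
    simp only
    lia
  · rw [if_neg hp, zero_add]
    by_cases hp' : 0 < p.1 ∧ p.1 ≤ N
    · rw [Finset.sum_eq_single_of_mem p.1.toNat]
      · rw [if_pos (Int.toNat_of_nonneg hp'.1.le).symm]
      · rw [Finset.mem_Ioc]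
        lia
      · intro c _ hc
        rw [if_neg]
        lia
    · rw [h0 p hp hp']
      simp

/-! ### Periodization of a compactly supported function -/

section Periodization

variable {f : ℝ → ℂ} {R : ℝ}

theorem comp_add_int_eq_zero (h0 : ∀ x, R < |x| → f x = 0) (x : ℝ) :
    ∀ q : ℤ, q ∉ Finset.Icc ⌊-R - |x|⌋ ⌈R + |x|⌉ → f (x + q) = 0 := by
  intro q hq
  refine h0 _ (not_le.mp fun hc ↦ hq ?_)
  rw [abs_le] at hc
  have h1 := neg_abs_le x
  have h2 := le_abs_self x
  rw [Finset.mem_Icc]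
  constructor
  · have : (⌊-R - |x|⌋ : ℝ) ≤ q := (Int.floor_le _).trans (by linarith)
    exact_mod_cast this
  · have : (q : ℝ) ≤ ⌈R + |x|⌉ := le_trans (by linarith) (Int.le_ceil _)
    exact_mod_cast this

theorem summable_comp_add_int (h0 : ∀ x, R < |x| → f x = 0) (x : ℝ) :
    Summable fun q : ℤ ↦ f (x + q) :=
  summable_of_ne_finset_zero (comp_add_int_eq_zero h0 x)

/-- The Fourier transform `∫ f(x) e(-x ξ) dx`. -/
noncomputable def fourierInt (f : ℝ → ℂ) (ξ : ℝ) : ℂ := ∫ x : ℝ, f x * e (-(x * ξ))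

theorem fourierInt_eq (f : ℝ → ℂ) (ξ : ℝ) : FourierTransform.fourier f ξ = fourierInt f ξ := by
  rw [Real.fourier_real_eq_integral_exp_smul, fourierInt]
  refine integral_congr_ae (Filter.Eventually.of_forall fun x ↦ ?_)
  simp only [e, smul_eq_mul]
  rw [mul_comm]
  congr 2
  push_cast
  ring

/-- The Fourier coefficients of the translated periodization `∑ f(x + θ + q)`. -/
theorem integral_periodization (hf : Continuous f) (h0 : ∀ x, R < |x| → f x = 0) (θ : ℝ) (n : ℤ) :
    IntervalIntegrable (fun x : ℝ ↦ (∑' q : ℤ, f (x + θ + q)) * e (-(n * x))) volume 0 1 ∧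
      ∫ x in (0 : ℝ)..1, (∑' q : ℤ, f (x + θ + q)) * e (-(n * x)) =
        e (n * θ) * fourierInt f n := by
  have he := continuous_e
  set g : ℝ → ℂ := fun x ↦ f (x + θ) * e (-(n * x)) with hg
  have hgc : Continuous g := by fun_prop
  set M : ℝ := R + |θ| + 1 with hM
  set Q : Finset ℤ := Finset.Icc ⌊-M⌋ ⌈M⌉ with hQ
  have hgq : ∀ q : ℤ, ∀ x : ℝ, g (x + q) = f (x + θ + q) * e (-(n * x)) := by
    intro q x
    simp only [hg]
    have : (-(n * (x + q)) : ℝ) = -(n * x) + ((-(n * q) : ℤ) : ℝ) := by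
      push_cast
      ring
    rw [this, e_add, e_int, mul_one, show x + q + θ = x + θ + q by ring]
  have hzero : ∀ x ∈ uIcc (0 : ℝ) 1, ∀ q ∉ Q, f (x + θ + q) = 0 := by
    intro x hx q hq
    rw [uIcc_of_le zero_le_one] at hx
    refine h0 _ (not_le.mp fun hc ↦ hq ?_)
    rw [abs_le] at hc
    have h1 := neg_abs_le θ
    have h2 := le_abs_self θ
    rw [hQ, Finset.mem_Icc]
    constructor
    · have : (⌊-M⌋ : ℝ) ≤ q := (Int.floor_le _).trans (by rw [hM]; linarith [hx.1, hx.2])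
      exact_mod_cast this
    · have : (q : ℝ) ≤ ⌈M⌉ := le_trans (by rw [hM]; linarith [hx.1, hx.2]) (Int.le_ceil _)
      exact_mod_cast this
  have hsum : EqOn (fun x : ℝ ↦ (∑' q : ℤ, f (x + θ + q)) * e (-(n * x)))
      (fun x ↦ ∑ q ∈ Q, g (x + q)) (uIcc 0 1) := by
    intro x hx
    simp only
    rw [tsum_eq_sum (s := Q) (hzero x hx), Finset.sum_mul]
    exact Finset.sum_congr rfl fun q _ ↦ (hgq q x).symm
  have hcs : HasCompactSupport g := by
    refine HasCompactSupport.intro (isCompact_Icc (a := -R - θ) (b := R - θ)) fun x hx ↦ ?_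
    have : R < |x + θ| := by
      by_contra hc
      have := abs_le.mp (not_lt.mp hc)
      exact hx ⟨by linarith, by linarith⟩
    simp [hg, h0 _ this]
  constructor
  · refine IntervalIntegrable.congr (hsum.symm.mono uIoc_subset_uIcc) ?_
    exact Continuous.intervalIntegrable (by fun_prop) _ _
  · rw [intervalIntegral.integral_congr hsum, intervalIntegral.integral_finsetSum
      fun q _ ↦ Continuous.intervalIntegrable (by fun_prop) _ _]
    have h1 := (hgc.integrable_of_hasCompactSupport hcs).hasSum_intervalIntegral_comp_add_int
    have h2 : ∑' q : ℤ, ∫ x in (0 : ℝ)..1, g (x + q) = ∑ q ∈ Q, ∫ x in (0 : ℝ)..1, g (x + q) := by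
      refine tsum_eq_sum fun q hq ↦ ?_
      rw [intervalIntegral.integral_congr (g := fun _ ↦ (0 : ℂ))]
      · simp
      · intro x hx
        simp only
        rw [hgq, hzero x hx q hq, zero_mul]
    rw [← h2, h1.tsum_eq, fourierInt, ← integral_const_mul,
      ← integral_add_right_eq_self (fun x ↦ e (n * θ) * (f x * e (-(x * n)))) θ]
    refine integral_congr_ae (Filter.Eventually.of_forall fun x ↦ ?_)
    simp only [hg]
    rw [mul_left_comm, ← e_add]
    congr 2
    ring

theorem hasSum_periodization (hf : Continuous f) (h0 : ∀ x, R < |x| → f x = 0)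
    (hs : Summable fun n : ℤ ↦ fourierInt f n) (x : ℝ) :
    HasSum (fun n : ℤ ↦ fourierInt f n * e (n * x)) (∑' q : ℤ, f (x + q)) := by
  have hO : f =O[Filter.cocompact ℝ] fun x : ℝ ↦ |x| ^ (-(2 : ℝ)) := by
    refine Filter.EventuallyEq.trans_isBigO (f₂ := fun _ ↦ (0 : ℂ)) ?_
      (Asymptotics.isBigO_zero _ _)
    rw [Filter.EventuallyEq, Filter.eventually_iff_exists_mem]
    refine ⟨(Icc (-R) R)ᶜ, isCompact_Icc.compl_mem_cocompact, fun x hx ↦ h0 x ?_⟩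
    by_contra hc
    exact hx (abs_le.mp (not_lt.mp hc))
  have h1 := Real.tsum_eq_tsum_fourier_of_rpow_decay_of_summable hf one_lt_two hO
    (by simpa only [fourierInt_eq] using hs) x
  rw [h1]
  simp only [fourierInt_eq]
  have h2 : ∀ n : ℤ, fourier n (x : UnitAddCircle) = e (n * x) := by
    intro n
    rw [fourier_coe_apply, e]
    congr 1
    push_cast
    ring
  simp only [h2]
  refine Summable.hasSum (Summable.of_norm ?_)
  simpa [norm_mul, norm_e] using hs.norm

end Periodization

end

section

open MeasureTheory Set
open scoped ContDiff

variable {ρ ψ : ℝ → ℂ} {α β : ℝ}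

/-! ### The contribution of a single modulus -/

/-- The contribution of the bottom row `(c, 0)` at the point `x + i y`, in terms of
`ρ(t) = ψ(1/t)`. The row `(c, d)` contributes the translate by `d / c`. -/
noncomputable def rowFun (ρ : ℝ → ℂ) (k : ℤ) (y : ℝ) (c : ℕ) (x : ℝ) : ℂ :=
  ρ ((x ^ 2 + y ^ 2) * c ^ 2 / y) * twist k y x

theorem continuous_rowFun (h : IsBump ρ α β) {k : ℤ} (hk : Even k) {y : ℝ} (hy : 0 < y) (c : ℕ) :
    Continuous (rowFun ρ k y c) := by
  have h1 := continuous_twist hk hy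
  have h2 := h.continuous
  unfold rowFun
  fun_prop

theorem rowFun_eq_zero (h : IsBump ρ α β) (k : ℤ) {y : ℝ} (hy : 0 < y) {c : ℕ}
    (hc : √β < √y * c) (x : ℝ) : rowFun ρ k y c x = 0 := by
  rw [rowFun, h.eq_zero, zero_mul]
  intro hmem
  have h1 := hmem.2
  rw [div_le_iff₀ hy] at h1
  have h2 : β < y * c ^ 2 := by
    have := mul_self_lt_mul_self (Real.sqrt_nonneg β) hc
    rw [Real.mul_self_sqrt h.beta_pos.le] at this
    nlinarith [Real.mul_self_sqrt hy.le]
  have h3 : 0 ≤ x ^ 2 * (c : ℝ) ^ 2 := by positivity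
  nlinarith

theorem rowFun_eq_zero_of_lt (h : IsBump ρ α β) (k : ℤ) {y : ℝ} (hy : 0 < y) {c : ℕ}
    (hc : 0 < c) (x : ℝ) (hx : √(β * y / c ^ 2) < |x|) : rowFun ρ k y c x = 0 := by
  have hc' : (0 : ℝ) < c := by exact_mod_cast hc
  rw [rowFun, h.eq_zero, zero_mul]
  intro hmem
  have h1 := hmem.2
  rw [div_le_iff₀ hy] at h1
  refine hx.not_ge (Real.abs_le_sqrt ?_)
  rw [le_div_iff₀ (by positivity)]
  have h3 : 0 ≤ y ^ 2 * (c : ℝ) ^ 2 := by positivity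
  nlinarith

theorem fourierInt_rowFun (ρ : ℝ → ℂ) (k : ℤ) {y : ℝ} (hy : 0 < y) {c : ℕ} (hc : 0 < c) (ξ : ℝ) :
    fourierInt (rowFun ρ k y c) ξ =
      ((√y / c : ℝ) : ℂ) * oscInt 0 0 ρ k (√y * c) (ξ * √y / c) := by
  have hc' : (0 : ℝ) < c := by exact_mod_cast hc
  have hs : 0 < √y := Real.sqrt_pos.mpr hy
  have hss : √y * √y = y := Real.mul_self_sqrt hy.le
  set s : ℝ := √y / c with hsdef
  have hs0 : 0 < s := by positivity
  have h1 := Measure.integral_comp_mul_left (fun x ↦ rowFun ρ k y c x * e (-(x * ξ))) s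
  rw [abs_of_pos (inv_pos.mpr hs0), Complex.real_smul] at h1
  have hsC : (s : ℂ) ≠ 0 := by exact_mod_cast hs0.ne'
  have h2 : fourierInt (rowFun ρ k y c) ξ =
      (s : ℂ) * ∫ v : ℝ, rowFun ρ k y c (s * v) * e (-(s * v * ξ)) := by
    rw [h1, fourierInt]
    push_cast
    rw [mul_inv_cancel_left₀ hsC]
  rw [h2, oscInt]
  congr 1
  refine integral_congr_ae (Filter.Eventually.of_forall fun v ↦ ?_)
  have hyu : y = s * (√y * c) := by
    rw [hsdef]
    field_simp
    rw [sq, hss]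
  have h3 : twist k y (s * v) = twist k (√y * c) v := by
    conv_lhs => rw [hyu]
    exact twist_mul k hs0 _ _
  have h4 : ((s * v) ^ 2 + y ^ 2) * (c : ℝ) ^ 2 / y = v ^ 2 + (√y * c) ^ 2 := by
    rw [hsdef, div_mul_eq_mul_div, div_pow, mul_pow, mul_pow, Real.sq_sqrt hy.le]
    field_simp
  simp only [rowFun, h3, h4, pow_zero, one_mul]
  congr 2
  rw [hsdef]
  ring

theorem summable_fourierInt_rowFun (h : IsBump ρ α β) {k : ℤ} (hk : Even k) {y : ℝ} (hy : 0 < y)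
    {c : ℕ} (hc : 0 < c) : Summable fun n : ℤ ↦ fourierInt (rowFun ρ k y c) n := by
  have hc' : (0 : ℝ) < c := by exact_mod_cast hc
  have hs : 0 < √y := Real.sqrt_pos.mpr hy
  obtain ⟨C, hC, H⟩ := exists_norm_oscInt_le_pow 2 0 0 ρ α β h
  have hsum : Summable fun n : ℤ ↦
      √y / c * (C * (max 1 (k.natAbs : ℝ) / (√y / c)) ^ 2) * (1 / (n : ℝ) ^ 2) :=
    (Real.summable_one_div_int_pow.mpr one_lt_two).mul_left _
  refine hsum.of_norm_bounded_eventually ?_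
  have hfin : {n : ℤ | ¬ ‖fourierInt (rowFun ρ k y c) n‖ ≤
      √y / c * (C * (max 1 (k.natAbs : ℝ) / (√y / c)) ^ 2) * (1 / (n : ℝ) ^ 2)} ⊆ {0} := by
    intro n hn
    by_contra hn0
    refine hn ?_
    have hn' : (n : ℝ) ≠ 0 := by exact_mod_cast hn0
    have h1 := H k hk (√y * c) (by positivity) (n * √y / c) (by positivity)
    rw [fourierInt_rowFun ρ k hy hc, norm_mul, Complex.norm_real, Real.norm_of_nonneg (by positivity),
      mul_assoc]
    refine mul_le_mul_of_nonneg_left (h1.trans (le_of_eq ?_)) (by positivity)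
    rw [abs_div, abs_mul, abs_of_pos hs, abs_of_pos hc', div_pow, div_pow, div_pow, mul_pow, sq_abs]
    field_simp
  exact (Set.finite_singleton 0).subset hfin

theorem rowSummand_point (k : ℤ) (ψ : ℝ → ℂ) (x : ℝ) {y : ℝ} (hy : 0 < y) {c : ℕ} (hc : 0 < c)
    (d : ℤ) : rowSummand k ψ (point x y hy) ((c : ℤ), d) =
      rowFun (fun t ↦ ψ t⁻¹) k y c (x + d / c) := by
  have hc' : (0 : ℝ) < c := by exact_mod_cast hc
  have h1 : (((c : ℤ) : ℂ) * (point x y hy : ℂ) + (d : ℂ)) =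
      ((c * (x + d / c) : ℝ) : ℂ) + ((c * y : ℝ) : ℂ) * Complex.I := by
    have hcc : (c : ℂ) ≠ 0 := by exact_mod_cast hc'.ne'
    have h2 : (point x y hy : ℂ) = x + y * Complex.I := by
      apply Complex.ext <;> simp [point]
    rw [h2]
    push_cast
    field_simp
    ring
  have h3 : (point x y hy).im = y := rfl
  rw [rowSummand, h1, rowFun, ← twist_mul k hc' y (x + d / c), twist, Complex.normSq_add_mul_I, h3]
  congr 2
  field_simp

theorem rowSummand_zero_one (k : ℤ) (ψ : ℝ → ℂ) (x : ℝ) {y : ℝ} (hy : 0 < y) :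
    rowSummand k ψ (point x y hy) (0, 1) = ψ y := by
  have h3 : (point x y hy).im = y := rfl
  simp [rowSummand, h3]

/-! ### The Fourier expansion -/

/-- The incomplete Eisenstein series as a finite sum of periodizations. -/
theorem hasSum_cosetSummand_point (h : IsBump (fun t ↦ ψ t⁻¹) α β) {k : ℤ} (hk : Even k) (x : ℝ)
    {y : ℝ} (hy : 0 < y) {N : ℕ} (hN : ∀ c : ℕ, N < c → √β < √y * c) :
    HasSum (cosetSummand k hk ψ (point x y hy)) (ψ y + ∑ c ∈ Finset.Ioc 0 N,
      ∑ r ∈ (Finset.range c).filter c.Coprime,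
        ∑' q : ℤ, rowFun (fun t ↦ ψ t⁻¹) k y c (x + r / c + q)) := by
  rw [hasSum_cosetSummand_iff]
  have h01 : ((0, 1) : ℤ × ℤ) ∈ normalizedRows := ⟨isCoprime_zero_left.mpr isUnit_one, Or.inr rfl⟩
  have hsplit := hasSum_of_rows (F := normalizedRows.indicator (rowSummand k ψ (point x y hy)))
    (N := N) (S := fun c ↦ ∑ r ∈ (Finset.range c).filter c.Coprime,
        ∑' q : ℤ, rowFun (fun t ↦ ψ t⁻¹) k y c (x + r / c + q)) ?_ ?_
  · rwa [indicator_of_mem h01, rowSummand_zero_one] at hsplit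
  · intro p hp hpN
    by_cases hpm : p ∈ normalizedRows
    · have hp0 : 0 < p.1 := hpm.2.resolve_right hp
      rw [indicator_of_mem hpm]
      have hpc : p = (((p.1.toNat : ℕ) : ℤ), p.2) := by
        rw [Int.toNat_of_nonneg hp0.le]
      rw [hpc, rowSummand_point k ψ x hy (by lia)]
      refine rowFun_eq_zero h k hy (hN _ ?_) _
      lia
    · exact indicator_of_notMem hpm _
  · intro c hc
    rw [Finset.mem_Ioc] at hc
    have hc' : (c : ℝ) ≠ 0 := by exact_mod_cast hc.1.ne'
    rw [Finset.sum_filter]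
    refine hasSum_int_of_residues hc.1 fun r hr ↦ ?_
    have hcop : ∀ q : ℤ, (((c : ℤ), r + c * q) ∈ normalizedRows ↔ c.Coprime r) := by
      intro q
      rw [← Nat.isCoprime_iff_coprime]
      have h1 : IsCoprime (c : ℤ) (r + c * q) ↔ IsCoprime (c : ℤ) r :=
        IsCoprime.add_mul_left_right_iff
      constructor
      · exact fun h ↦ h1.mp h.1
      · exact fun h ↦ ⟨h1.mpr h, Or.inl (Int.natCast_pos.mpr hc.1)⟩
    split_ifs with hr'
    · refine (summable_comp_add_int (rowFun_eq_zero_of_lt h k hy hc.1) (x + r / c)).hasSum.congr_fun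
        fun q ↦ ?_
      rw [indicator_of_mem ((hcop q).mpr hr'), rowSummand_point k ψ x hy hc.1]
      congr 1
      push_cast
      field_simp
      ring
    · have : ∀ q : ℤ, normalizedRows.indicator (rowSummand k ψ (point x y hy))
          ((c : ℤ), r + c * q) = 0 := fun q ↦ indicator_of_notMem (fun hm ↦ hr' ((hcop q).mp hm)) _
      simp only [this]
      exact hasSum_zero

theorem integral_e_neg_mul (n : ℤ) :
    ∫ x in (0 : ℝ)..1, e (-(n * x)) = if n = 0 then 1 else 0 := by
  split_ifs with hn
  · simp [hn, e_zero]
  · have hn' : (2 * Real.pi * Complex.I * ((n : ℝ) : ℂ)) ≠ 0 := by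
      refine mul_ne_zero Complex.two_pi_I_ne_zero ?_
      exact_mod_cast hn
    have h1 : ∀ x ∈ uIcc (0 : ℝ) 1, HasDerivAt
        (fun x : ℝ ↦ (-(2 * Real.pi * Complex.I * ((n : ℝ) : ℂ)))⁻¹ * e (-(x * n)))
        (e (-(n * x))) x := by
      intro x _
      refine ((hasDerivAt_e_neg_mul n x).const_mul _).congr_deriv ?_
      rw [inv_mul_cancel_left₀ (neg_ne_zero.mpr hn'), mul_comm]
    have he := continuous_e
    rw [intervalIntegral.integral_eq_sub_of_hasDerivAt h1
      (Continuous.intervalIntegrable (by fun_prop) _ _)]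
    have h2 : e (-(1 * (n : ℝ))) = 1 := by
      have := e_int (-n)
      push_cast at this
      rwa [one_mul]
    rw [h2, zero_mul, neg_zero, e_zero, sub_self]

theorem coeff_eq (h : IsBump (fun t ↦ ψ t⁻¹) α β) {k : ℤ} (hk : Even k) (n : ℤ)
    {y : ℝ} (hy : 0 < y) {N : ℕ} (hN : ∀ c : ℕ, N < c → √β < √y * c) :
    coeff k hk ψ n y hy = (if n = 0 then ψ y else 0) + ∑ c ∈ Finset.Ioc 0 N,
      ramanujanSum n c * fourierInt (rowFun (fun t ↦ ψ t⁻¹) k y c) n := by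
  have he := continuous_e
  have hper := fun (c : ℕ) (hc : c ∈ Finset.Ioc 0 N) (r : ℕ) ↦
    integral_periodization (continuous_rowFun h hk hy c)
      (rowFun_eq_zero_of_lt h k hy (Finset.mem_Ioc.mp hc).1) (r / c) n
  have e1 : ∀ x : ℝ, incompleteEisenstein k hk ψ (point x y hy) * e (-(n * x)) =
      ψ y * e (-(n * x)) + ∑ c ∈ Finset.Ioc 0 N, ∑ r ∈ (Finset.range c).filter c.Coprime,
        (∑' q : ℤ, rowFun (fun t ↦ ψ t⁻¹) k y c (x + r / c + q)) * e (-(n * x)) := by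
    intro x
    rw [incompleteEisenstein, (hasSum_cosetSummand_point h hk x hy hN).tsum_eq, add_mul,
      Finset.sum_mul]
    congr 1
    exact Finset.sum_congr rfl fun c _ ↦ by rw [Finset.sum_mul]
  have i2 : ∀ c ∈ Finset.Ioc 0 N, IntervalIntegrable (fun x : ℝ ↦
      ∑ r ∈ (Finset.range c).filter c.Coprime,
        (∑' q : ℤ, rowFun (fun t ↦ ψ t⁻¹) k y c (x + r / c + q)) * e (-(n * x))) volume 0 1 := by
    intro c hc
    have := IntervalIntegrable.sum ((Finset.range c).filter c.Coprime)
      fun r _ ↦ (hper c hc r).1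
    simpa only [Finset.sum_fn] using this
  have i3 : IntervalIntegrable (fun x : ℝ ↦ ∑ c ∈ Finset.Ioc 0 N,
      ∑ r ∈ (Finset.range c).filter c.Coprime,
        (∑' q : ℤ, rowFun (fun t ↦ ψ t⁻¹) k y c (x + r / c + q)) * e (-(n * x))) volume 0 1 := by
    have := IntervalIntegrable.sum (Finset.Ioc 0 N) i2
    simpa only [Finset.sum_fn] using this
  rw [coeff]
  simp only [e1]
  rw [intervalIntegral.integral_add (Continuous.intervalIntegrable (by fun_prop) _ _) i3,
    intervalIntegral.integral_const_mul, integral_e_neg_mul,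
    intervalIntegral.integral_finsetSum i2]
  congr 1
  · simp
  · refine Finset.sum_congr rfl fun c hc ↦ ?_
    rw [intervalIntegral.integral_finsetSum fun r _ ↦ (hper c hc r).1, ramanujanSum, Finset.sum_mul]
    refine Finset.sum_congr rfl fun r _ ↦ ?_
    rw [(hper c hc r).2, mul_div_assoc]

theorem exists_nat_forall_lt {β y : ℝ} (hy : 0 < y) : ∃ N : ℕ, (N : ℝ) ≤ √β / √y ∧
    ∀ c : ℕ, N < c → √β < √y * c := by
  have hs : 0 < √y := Real.sqrt_pos.mpr hy
  refine ⟨⌊√β / √y⌋₊, Nat.floor_le (by positivity), fun c hc ↦ ?_⟩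
  have := Nat.lt_of_floor_lt hc
  rwa [div_lt_iff₀ hs, mul_comm] at this

theorem hasSum_coeff (h : IsBump (fun t ↦ ψ t⁻¹) α β) {k : ℤ} (hk : Even k) (x : ℝ)
    {y : ℝ} (hy : 0 < y) : HasSum (fun n : ℤ ↦ coeff k hk ψ n y hy * e (n * x))
      (incompleteEisenstein k hk ψ (point x y hy)) := by
  obtain ⟨N, -, hN⟩ := exists_nat_forall_lt (β := β) hy
  rw [incompleteEisenstein, (hasSum_cosetSummand_point h hk x hy hN).tsum_eq]
  have h1 : HasSum (fun n : ℤ ↦ if n = 0 then ψ y else 0) (ψ y) := by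
    simpa using hasSum_ite_eq (0 : ℤ) (ψ y)
  have h2 := h1.add (hasSum_sum fun c (hc : c ∈ Finset.Ioc 0 N) ↦
    hasSum_sum fun r (_ : r ∈ (Finset.range c).filter c.Coprime) ↦
      hasSum_periodization (continuous_rowFun h hk hy c)
        (rowFun_eq_zero_of_lt h k hy (Finset.mem_Ioc.mp hc).1)
        (summable_fourierInt_rowFun h hk hy (Finset.mem_Ioc.mp hc).1) (x + r / c))
  refine h2.congr_fun fun n ↦ ?_
  rw [coeff_eq h hk n hy hN, add_mul, Finset.sum_mul]
  congr 1
  · split_ifs with hn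
    · simp [hn, e_zero]
    · simp
  · refine Finset.sum_congr rfl fun c _ ↦ ?_
    rw [ramanujanSum, Finset.sum_mul, Finset.sum_mul]
    refine Finset.sum_congr rfl fun r _ ↦ ?_
    rw [mul_add, e_add, mul_div_assoc]
    ring

/-! ### Bounds for the coefficients -/

/-- The support of `ψ` is a compact set of positive reals, so `t ↦ ψ(1/t)` vanishes near `t = 0`, where
the convention `0⁻¹ = 0` is therefore harmless. -/
theorem isBump_comp_inv (hψ : ContDiff ℝ ∞ ψ) (hcpt : HasCompactSupport ψ)
    (hpos : tsupport ψ ⊆ Ioi 0) : ∃ α β, IsBump (fun t ↦ ψ t⁻¹) α β := by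
  obtain ⟨a, b, ha, hab, hsupp⟩ : ∃ a b : ℝ, 0 < a ∧ a ≤ b ∧ ∀ x, ψ x ≠ 0 → x ∈ Icc a b := by
    rcases (tsupport ψ).eq_empty_or_nonempty with he | hne
    · refine ⟨1, 1, one_pos, le_rfl, fun x hx ↦ ?_⟩
      have := subset_tsupport ψ hx
      simp [he] at this
    · have hK : IsCompact (tsupport ψ) := hcpt
      obtain ⟨a, ha, hamin⟩ := hK.exists_isLeast hne
      obtain ⟨b, hb, hbmax⟩ := hK.exists_isGreatest hne
      exact ⟨a, b, hpos ha, hamin hb, fun x hx ↦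
        ⟨hamin (subset_tsupport ψ hx), hbmax (subset_tsupport ψ hx)⟩⟩
  have hb : 0 < b := ha.trans_le hab
  have hz : ∀ x : ℝ, x ∉ Icc b⁻¹ a⁻¹ → ψ x⁻¹ = 0 := by
    intro x hx
    by_contra hc
    have hm := hsupp _ hc
    have hx0 : 0 < x := inv_pos.mp (ha.trans_le hm.1)
    exact hx ⟨(inv_le_comm₀ hb hx0).mpr hm.2, (le_inv_comm₀ ha hx0).mp hm.1⟩
  refine ⟨b⁻¹, a⁻¹, ?_, inv_pos.mpr hb, (inv_le_inv₀ hb ha).mpr hab, hz⟩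
  rw [contDiff_iff_contDiffAt]
  intro x
  rcases lt_or_ge 0 x with hx | hx
  · exact hψ.contDiffAt.comp x (contDiffAt_inv ℝ hx.ne')
  · have hx' : x ∉ Icc b⁻¹ a⁻¹ := fun hc ↦ ((inv_pos.mpr hb).trans_le hc.1).not_ge hx
    refine (contDiffAt_const (c := (0 : ℂ))).congr_of_eventuallyEq ?_
    filter_upwards [isClosed_Icc.isOpen_compl.mem_nhds hx'] with t ht
    exact hz t ht

theorem mellin_neg_one (h : IsBump (fun t ↦ ψ t⁻¹) α β) : mellin ψ (-1) = ∫ x, ψ x⁻¹ := by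
  rw [← mellin_comp_inv, mellin, ← h.integral_Ioi]
  simp

/-- The term `ψ(y)` of the coset `Γ_∞` is `O(√y)` because `ψ` vanishes near `0`. -/
theorem exists_norm_coeff_zero_sub_le (h : IsBump (fun t ↦ ψ t⁻¹) α β) :
    ∃ C : ℝ, ∀ (k : ℤ) (hk : Even k) (y : ℝ) (hy : 0 < y),
      ‖coeff k hk ψ 0 y hy - (if k = 0 then (3 / Real.pi : ℂ) * mellin ψ (-1) else 0)‖ ≤
        C * √y := by
  obtain ⟨C, hC, H⟩ := exists_norm_sum_totient_lineInt_sub_le h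
  obtain ⟨M, hM, HM⟩ := h.exists_bound
  have hβ := h.beta_pos
  refine ⟨M * √β + C, fun k hk y hy ↦ ?_⟩
  have hs : 0 < √y := Real.sqrt_pos.mpr hy
  have hsC : ((√y : ℝ) : ℂ) ≠ 0 := by exact_mod_cast hs.ne'
  obtain ⟨N, -, hN⟩ := exists_nat_forall_lt (β := β) hy
  have hN1 := hN (N + 1) (Nat.lt_succ_self N)
  have e1 : coeff k hk ψ 0 y hy = ψ y + (√y : ℂ) *
      ∑ c ∈ Finset.Ioc 0 (N + 1), (Nat.totient c : ℂ) / c *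
        lineInt (fun t ↦ ψ t⁻¹) k (√y * c) := by
    rw [coeff_eq h hk 0 hy (N := N + 1) fun c hc ↦ hN c (by lia), if_pos rfl, Finset.mul_sum]
    congr 1
    refine Finset.sum_congr rfl fun c hc ↦ ?_
    rw [fourierInt_rowFun _ k hy (Finset.mem_Ioc.mp hc).1, ramanujanSum_zero]
    rw [Int.cast_zero, zero_mul, zero_div, oscInt_zero_zero]
    push_cast
    ring
  have b1 : ‖ψ y‖ ≤ M * √β * √y := by
    by_cases hz : ψ y = 0
    · rw [hz, norm_zero]
      positivity
    · have hmem : y⁻¹ ∈ Icc α β := h.mem_Icc_of_ne_zero (by simpa using hz)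
      have h1 : 1 ≤ √β * √y := by
        rw [← Real.sqrt_mul hβ.le, Real.one_le_sqrt]
        exact (inv_le_iff_one_le_mul₀ hy).mp hmem.2
      have h2 := HM y⁻¹
      rw [inv_inv] at h2
      calc ‖ψ y‖ ≤ M * 1 := by rwa [mul_one]
        _ ≤ M * (√β * √y) := by gcongr
        _ = _ := by ring
  have hH := H k hk (√y) hs (N + 1) (by lia) hN1
  rw [← mellin_neg_one h] at hH
  have e2 : coeff k hk ψ 0 y hy - (if k = 0 then (3 / Real.pi : ℂ) * mellin ψ (-1) else 0) =
      ψ y + (√y : ℂ) * (∑ c ∈ Finset.Ioc 0 (N + 1), (Nat.totient c : ℂ) / c *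
        lineInt (fun t ↦ ψ t⁻¹) k (√y * c) -
        ((√y : ℝ) : ℂ)⁻¹ * ((if k = 0 then 3 / (Real.pi : ℂ) else 0) * mellin ψ (-1))) := by
    rw [e1, mul_sub, mul_inv_cancel_left₀ hsC, ite_mul, zero_mul]
    ring
  rw [e2]
  refine (norm_add_le _ _).trans ?_
  rw [norm_mul, Complex.norm_real, Real.norm_of_nonneg hs.le]
  have := mul_le_mul_of_nonneg_left hH hs.le
  linarith

/-- Any bound of order `κ > 0` for the oscillatory integral passes to the Fourier coefficients: the sum
over the moduli `c ≤ √β / √y` replaces `|ξ|` by `|n| y`. -/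
theorem exists_norm_coeff_le (h : IsBump (fun t ↦ ψ t⁻¹) α β) {κ : ℝ} (hκ : 0 < κ) {C : ℝ}
    (hC : 0 ≤ C) (H : ∀ (k : ℤ), Even k → ∀ u : ℝ, 0 < u → ∀ ξ : ℝ, ξ ≠ 0 →
      ‖oscInt 0 0 (fun t ↦ ψ t⁻¹) k u ξ‖ ≤ C * (max 1 (k.natAbs : ℝ) / |ξ|) ^ κ) :
    ∃ C' : ℝ, 0 ≤ C' ∧ ∀ (k : ℤ) (hk : Even k) (n : ℤ), n ≠ 0 → ∀ (y : ℝ) (hy : 0 < y),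
      ‖coeff k hk ψ n y hy‖ ≤ C' * max 1 (k.natAbs : ℝ) ^ κ * √y * tau n.natAbs *
        (1 / (n.natAbs * y)) ^ κ := by
  refine ⟨C * (1 + 1 / κ) * √β ^ κ, by positivity, fun k hk n hn y hy ↦ ?_⟩
  obtain ⟨N, hNle, hN⟩ := exists_nat_forall_lt (β := β) hy
  have hs : 0 < √y := Real.sqrt_pos.mpr hy
  have hn0 : (0 : ℝ) < n.natAbs := by exact_mod_cast Int.natAbs_pos.mpr hn
  set K := max 1 (k.natAbs : ℝ) with hK
  have hK1 : 1 ≤ K := le_max_left _ _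
  rw [coeff_eq h hk n hy hN, if_neg hn, zero_add]
  calc ‖∑ c ∈ Finset.Ioc 0 N, ramanujanSum n c * fourierInt (rowFun (fun t ↦ ψ t⁻¹) k y c) n‖
      ≤ ∑ c ∈ Finset.Ioc 0 N, √y * C * (K / (n.natAbs * √y)) ^ κ *
          (‖ramanujanSum n c‖ * (c : ℝ) ^ (κ - 1)) := by
        refine (norm_sum_le _ _).trans (Finset.sum_le_sum fun c hc ↦ ?_)
        rw [Finset.mem_Ioc] at hc
        have hc0 : (0 : ℝ) < c := by exact_mod_cast hc.1
        have hn' : (n : ℝ) ≠ 0 := by exact_mod_cast hn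
        have hH := H k hk (√y * c) (by positivity) (n * √y / c) (by positivity)
        rw [norm_mul, fourierInt_rowFun _ k hy hc.1, norm_mul, Complex.norm_real,
          Real.norm_of_nonneg (by positivity)]
        have habs : |(n : ℝ) * √y / c| = n.natAbs * √y / c := by
          rw [abs_div, abs_mul, abs_of_pos hs, abs_of_pos hc0, Nat.cast_natAbs, Int.cast_abs]
        rw [habs] at hH
        calc _ ≤ ‖ramanujanSum n c‖ * (√y / c * (C * (K / (n.natAbs * √y / c)) ^ κ)) := by gcongr
          _ = _ := by
            rw [show K / (n.natAbs * √y / c) = K / (n.natAbs * √y) * c by field_simp,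
              Real.mul_rpow (by positivity) hc0.le, Real.rpow_sub_one hc0.ne']
            ring
    _ ≤ √y * C * (K / (n.natAbs * √y)) ^ κ *
          ((1 + 1 / κ) * tau n.natAbs * (√β / √y) ^ κ) := by
        rw [← Finset.mul_sum]
        refine mul_le_mul_of_nonneg_left ((sum_norm_ramanujanSum_le hκ hn N).trans ?_)
          (by positivity)
        gcongr
    _ = √y * C * ((1 + 1 / κ) * tau n.natAbs) *
          (K / (n.natAbs * √y) * (√β / √y)) ^ κ := by
        rw [Real.mul_rpow (x := K / (n.natAbs * √y)) (by positivity) (by positivity)]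
        ring
    _ = √y * C * ((1 + 1 / κ) * tau n.natAbs) * (K * √β * (1 / (n.natAbs * y))) ^ κ := by
        congr 2
        rw [div_mul_div_comm, mul_assoc, Real.mul_self_sqrt hy.le]
        ring
    _ = _ := by
        rw [Real.mul_rpow (by positivity) (by positivity), Real.mul_rpow (by positivity)
          (by positivity)]
        ring

theorem exists_norm_coeff_le_pow (h : IsBump (fun t ↦ ψ t⁻¹) α β) {ε : ℝ} (hε : 0 < ε) (A : ℕ) :
    ∃ C : ℝ, 0 ≤ C ∧ ∀ (k : ℤ) (hk : Even k) (n : ℤ), n ≠ 0 → ∀ (y : ℝ) (hy : 0 < y),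
      ‖coeff k hk ψ n y hy‖ ≤ C * 2 ^ k.natAbs * (1 + (k.natAbs : ℝ)) ^ A * √y *
        (tau n.natAbs : ℝ) * (1 / ((n.natAbs : ℝ) * y)) ^ A *
        (1 + 1 / ((n.natAbs : ℝ) * y)) ^ ε := by
  have h2 : ∀ m : ℕ, max 1 (m : ℝ) ≤ 2 ^ m := fun m ↦
    max_le (one_le_pow₀ one_le_two) (by exact_mod_cast Nat.lt_two_pow_self.le)
  rcases Nat.eq_zero_or_pos A with rfl | hA
  · -- a small positive exponent avoids the logarithm from the sum over the moduli
    have hκ : 0 < min ε 1 := lt_min hε one_pos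
    obtain ⟨C, hC, H⟩ := exists_norm_oscInt_le_rpow h hκ.le (min_le_right ε 1)
    obtain ⟨C', hC', H'⟩ := exists_norm_coeff_le h hκ hC H
    refine ⟨C', hC', fun k hk n hn y hy ↦ (H' k hk n hn y hy).trans ?_⟩
    have hn0 : (0 : ℝ) < n.natAbs := by exact_mod_cast Int.natAbs_pos.mpr hn
    have hK1 : 1 ≤ max 1 (k.natAbs : ℝ) := le_max_left _ _
    have b1 : max 1 (k.natAbs : ℝ) ^ (min ε 1) ≤ 2 ^ k.natAbs :=
      (Real.rpow_le_self_of_one_le hK1 (min_le_right ε 1)).trans (h2 _)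
    have hx : 0 ≤ 1 / ((n.natAbs : ℝ) * y) := by positivity
    have b2 : (1 / ((n.natAbs : ℝ) * y)) ^ (min ε 1) ≤ (1 + 1 / ((n.natAbs : ℝ) * y)) ^ ε := by
      calc _ ≤ (1 + 1 / ((n.natAbs : ℝ) * y)) ^ (min ε 1) := by
            gcongr
            linarith
        _ ≤ _ := Real.rpow_le_rpow_of_exponent_le (by linarith) (min_le_left _ _)
    rw [pow_zero, pow_zero, mul_one, mul_one]
    gcongr
  · have hκ : (0 : ℝ) < A := by exact_mod_cast hA
    obtain ⟨C, hC, H⟩ := exists_norm_oscInt_le_pow A 0 0 _ α β h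
    obtain ⟨C', hC', H'⟩ := exists_norm_coeff_le h hκ hC (by simpa only [Real.rpow_natCast] using H)
    refine ⟨C', hC', fun k hk n hn y hy ↦ (H' k hk n hn y hy).trans ?_⟩
    rw [Real.rpow_natCast, Real.rpow_natCast]
    have hn0 : (0 : ℝ) < n.natAbs := by exact_mod_cast Int.natAbs_pos.mpr hn
    have hx : 0 ≤ 1 / ((n.natAbs : ℝ) * y) := by positivity
    have b1 : max 1 (k.natAbs : ℝ) ≤ 1 + k.natAbs := by
      apply max_le <;> linarith [Nat.cast_nonneg (α := ℝ) k.natAbs]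
    have b2 : 1 ≤ (1 + 1 / ((n.natAbs : ℝ) * y)) ^ ε :=
      Real.one_le_rpow (by linarith) hε.le
    have b3 : (1 : ℝ) ≤ 2 ^ k.natAbs := one_le_pow₀ one_le_two
    calc _ = C' * 1 * max 1 (k.natAbs : ℝ) ^ A * √y * tau n.natAbs *
          (1 / ((n.natAbs : ℝ) * y)) ^ A * 1 := by ring
      _ ≤ _ := by gcongr

end

end IncompleteEisenstein

theorem mainTheorem8 (ψ : ℝ → ℂ) (hψ : ContDiff ℝ (⊤ : ℕ∞) ψ) (hcpt : HasCompactSupport ψ)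
    (hpos : tsupport ψ ⊆ Set.Ioi 0) :
    -- the series and its Fourier expansion converge (absolutely)
    (∀ (k : ℤ) (hk : Even k),
      (∀ z : UpperHalfPlane, Summable (IncompleteEisenstein.cosetSummand k hk ψ z)) ∧
      ∀ (x y : ℝ) (hy : 0 < y),
        HasSum (fun n : ℤ => IncompleteEisenstein.coeff k hk ψ n y hy *
            IncompleteEisenstein.e (n * x))
          (IncompleteEisenstein.incompleteEisenstein k hk ψ
            (IncompleteEisenstein.point x y hy))) ∧
    -- the constant term
    (∃ C : ℝ, ∀ (k : ℤ) (hk : Even k) (y : ℝ) (hy : 0 < y),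
      ‖IncompleteEisenstein.coeff k hk ψ 0 y hy -
          (if k = 0 then (3 / Real.pi : ℂ) * mellin ψ (-1) else 0)‖ ≤ C * √y) ∧
    -- the other coefficients
    (∀ (ε : ℝ), 0 < ε → ∀ A : ℕ, ∃ C : ℝ,
      ∀ (k : ℤ) (hk : Even k) (n : ℤ), n ≠ 0 → ∀ (y : ℝ) (hy : 0 < y),
        ‖IncompleteEisenstein.coeff k hk ψ n y hy +
            IncompleteEisenstein.coeff k hk ψ (-n) y hy‖ ≤
          C * 2 ^ k.natAbs * (1 + (k.natAbs : ℝ)) ^ A * √y *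
            (IncompleteEisenstein.tau n.natAbs : ℝ) *
            (1 / ((n.natAbs : ℝ) * y)) ^ A * (1 + 1 / ((n.natAbs : ℝ) * y)) ^ ε) := by
  obtain ⟨α, β, h⟩ := IncompleteEisenstein.isBump_comp_inv hψ hcpt hpos
  refine ⟨fun k hk ↦ ⟨fun z ↦ ?_, fun x y hy ↦ IncompleteEisenstein.hasSum_coeff h hk x hy⟩,
    IncompleteEisenstein.exists_norm_coeff_zero_sub_le h, fun ε hε A ↦ ?_⟩
  · obtain ⟨N, -, hN⟩ := IncompleteEisenstein.exists_nat_forall_lt (β := β) z.im_pos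
    exact (IncompleteEisenstein.hasSum_cosetSummand_point h hk z.re z.im_pos hN).summable
  · obtain ⟨C, -, H⟩ := IncompleteEisenstein.exists_norm_coeff_le_pow h hε A
    refine ⟨2 * C, fun k hk n hn y hy ↦ (norm_add_le _ _).trans ?_⟩
    have h1 := H k hk n hn y hy
    have h2 := H k hk (-n) (neg_ne_zero.mpr hn) y hy
    rw [Int.natAbs_neg] at h2
    linarith
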